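/- Let $g(t)=2^{1/4}e^{-\pi t^2}$ and, for a (tempered) signal $y$ on $\mathbb R$ and $z=\tau+i\omega\in\mathbb C$, let $$\mathrm{Spec}_g(y)(z)=\Big|\int_{\mathbb R}y(t)\,g(t-\tau)\,e^{-2i\pi\omega t}\,dt\Big|^2 ,$$ the integral being read as the duality pairing when $y$ is a tempered distribution. Let $\xi$ be a complex white Gaussian noise on $\mathbb R$, that is, a random tempered distribution with $\mathbb E\,e^{i\,\mathrm{Re}\langle\xi,\varphi\rangle}=e^{-\|\varphi\|_{L^2}^2/4}$ for all Schwartz functions $\varphi$ (so that $\mathbb E|\langle\xi,\varphi\rangle|^2=\|\varphi\|_{L^2}^2$). For $b\in\mathbb R$ put $\sigma_b=\sqrt{2/(1+4b^2)}$. For real $a_1<a_2$ and $\gamma>0$ let $$x(t)=\sqrt{\gamma}\,e^{2i\pi t(a_1+bt)}+\sqrt{\gamma}\,e^{2i\pi t(a_2+bt)},$$ and put $a=\frac{\sigma_b}{\sqrt2}(a_2-a_1)>0$, $r=\frac{\sigma_b}{\sqrt2}(\omega-2b\tau-a_1)$ and $s=\frac{\sigma_b}{\sqrt2}(\tau+2b\omega-(a_1+a_2)b)$.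 For $N\in\mathbb N$ let $C_N\subset\mathbb C$ be the rectangle of the points $z=\tau+i\omega$ with $(r,s)\in[0,a]\times[N/a,(N+1)/a]$. Then for every $N\in\mathbb N$ there is a constant $M_N>0$, depending only on $N$, such that for all $\epsilon\in(0,1/4)$ and all $a_1<a_2$, $b$, $\gamma$ as above: if $$a\le\sqrt{\frac2\pi}\qquad\text{and}\qquad \gamma\ge\frac{4\big(M_N+\sqrt{\log(4/\epsilon)}\big)^2}{\sigma_b\,(1-e^{-\pi a^2})^2},$$ then, with probability greater than $1-\epsilon$, $\mathrm{Spec}_g(\xi+x)$ has a unique zero in $C_N$. -/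

import Mathlib

open scoped SchwartzMap

namespace NoisyChirps

noncomputable section

/-! ### The Gaussian window and its time-frequency shifts -/

/-- The Gaussian window `g(t) = 2^{1/4} exp(-π t²)`, normalized in `L²(ℝ)`. -/
def window (t : ℝ) : ℝ := (2 : ℝ) ^ (1 / 4 : ℝ) * Real.exp (-Real.pi * t ^ 2)

/-- The kernel `t ↦ g(t - τ) exp(-2 i π ω t)` of the short-time Fourier transform at the point
`z = τ + i ω` of the time-frequency plane. -/
def atomFun (z : ℂ) (t : ℝ) : ℂ :=
  (window (t - z.re) : ℂ) * Complex.exp (-(2 * Complex.I * Real.pi * z.im * t))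

lemma norm_atomFun (z : ℂ) (t : ℝ) :
    ‖atomFun z t‖ = (2 : ℝ) ^ (1 / 4 : ℝ) * Real.exp (-Real.pi * (t - z.re) ^ 2) := by
  have h : ‖Complex.exp (-(2 * Complex.I * Real.pi * z.im * t))‖ = 1 := by
    rw [Complex.norm_exp]
    simp
  rw [atomFun, norm_mul, h, mul_one, Complex.norm_real, Real.norm_eq_abs, window, abs_of_nonneg]
  positivity

lemma hasDerivAt_atomFun (z : ℂ) (t : ℝ) :
    HasDerivAt (atomFun z)
      ((-2 * Real.pi * t + (2 * Real.pi * z.re - 2 * Complex.I * Real.pi * z.im)) *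
        atomFun z t) t := by
  have h1 : HasDerivAt (fun t : ℝ => window (t - z.re))
      (window (t - z.re) * (-Real.pi * (2 * (t - z.re)))) t := by
    have h : HasDerivAt (fun t : ℝ => -Real.pi * (t - z.re) ^ 2)
        (-Real.pi * (2 * (t - z.re))) t := by
      have := (((hasDerivAt_id t).sub_const z.re).pow 2).const_mul (-Real.pi)
      simpa using this
    have := h.exp.const_mul ((2 : ℝ) ^ (1 / 4 : ℝ))
    simpa [window, mul_assoc] using this
  have h2 : HasDerivAt (fun t : ℝ => Complex.exp (-(2 * Complex.I * Real.pi * z.im * t)))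
      (Complex.exp (-(2 * Complex.I * Real.pi * z.im * t)) *
        (-(2 * Complex.I * Real.pi * z.im))) t := by
    have h : HasDerivAt (fun t : ℝ => -(2 * Complex.I * Real.pi * z.im * (t : ℂ)))
        (-(2 * Complex.I * Real.pi * z.im)) t := by
      have := ((hasDerivAt_id t).ofReal_comp.const_mul
        (2 * Complex.I * Real.pi * z.im : ℂ)).fun_neg
      simpa using this
    exact h.cexp
  have := h1.ofReal_comp.mul h2
  refine this.congr_deriv ?_
  simp only [atomFun]
  push_cast
  ring

/-- Every derivative of the kernel is a polynomial times the kernel. -/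
lemma iteratedDeriv_atomFun (z : ℂ) (n : ℕ) :
    ∃ p : Polynomial ℂ, iteratedDeriv n (atomFun z) = fun t : ℝ => p.eval (t : ℂ) * atomFun z t := by
  induction n with
  | zero => exact ⟨1, by simp⟩
  | succ n ih =>
    obtain ⟨p, hp⟩ := ih
    refine ⟨p.derivative + p * (Polynomial.C (-2 * Real.pi : ℂ) * Polynomial.X +
      Polynomial.C (2 * Real.pi * z.re - 2 * Complex.I * Real.pi * z.im : ℂ)), ?_⟩
    rw [iteratedDeriv_succ, hp]
    funext t
    have := (p.hasDerivAt (t : ℂ)).comp_ofReal.mul (hasDerivAt_atomFun z t)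
    refine Eq.trans this.deriv ?_
    simp only [Polynomial.eval_add, Polynomial.eval_mul, Polynomial.eval_C, Polynomial.eval_X]
    ring

lemma contDiff_atomFun (z : ℂ) : ContDiff ℝ ((⊤ : ℕ∞) : WithTop ℕ∞) (atomFun z) := by
  unfold atomFun window
  refine ContDiff.mul ?_ ?_
  · exact Complex.ofRealCLM.contDiff.comp (contDiff_const.mul (ContDiff.exp (by fun_prop)))
  · exact ContDiff.cexp ((contDiff_const.mul Complex.ofRealCLM.contDiff).neg)

lemma bounded_poly_mul_atomFun (z : ℂ) (p : Polynomial ℂ) :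
    ∃ C : ℝ, ∀ t : ℝ, ‖p.eval (t : ℂ) * atomFun z t‖ ≤ C := by
  induction p using Polynomial.induction_on' with
  | add p q hp hq =>
    obtain ⟨C, hC⟩ := hp
    obtain ⟨D, hD⟩ := hq
    refine ⟨C + D, fun t => ?_⟩
    rw [Polynomial.eval_add, add_mul]
    exact (norm_add_le _ _).trans (add_le_add (hC t) (hD t))
  | monomial m c =>
    refine ⟨‖c‖ * ((m.factorial : ℝ) * ((2 : ℝ) ^ (1 / 4 : ℝ) * Real.exp (1 + |z.re|))),
      fun t => ?_⟩
    rw [Polynomial.eval_monomial, norm_mul, norm_mul, norm_pow, Complex.norm_real,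
      Real.norm_eq_abs, norm_atomFun, mul_assoc]
    refine mul_le_mul_of_nonneg_left ?_ (norm_nonneg c)
    have h1 : |t| ^ m ≤ m.factorial * Real.exp |t| := by
      have := Real.pow_div_factorial_le_exp |t| (abs_nonneg t) m
      rwa [div_le_iff₀ (by positivity), mul_comm] at this
    have h2 : |t| + -Real.pi * (t - z.re) ^ 2 ≤ 1 + |z.re| := by
      have h3 : |t| ≤ |t - z.re| + |z.re| := by
        simpa using abs_add_le (t - z.re) z.re
      have h4 := Real.pi_gt_three
      have h5 := sq_abs (t - z.re)
      nlinarith [sq_nonneg (|t - z.re| - 1), sq_nonneg (|t - z.re|)]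
    calc |t| ^ m * ((2 : ℝ) ^ (1 / 4 : ℝ) * Real.exp (-Real.pi * (t - z.re) ^ 2))
        ≤ (m.factorial * Real.exp |t|) *
          ((2 : ℝ) ^ (1 / 4 : ℝ) * Real.exp (-Real.pi * (t - z.re) ^ 2)) := by gcongr
      _ = m.factorial * ((2 : ℝ) ^ (1 / 4 : ℝ) *
          Real.exp (|t| + -Real.pi * (t - z.re) ^ 2)) := by rw [Real.exp_add]; ring
      _ ≤ _ := by gcongr

/-- The kernel `t ↦ g(t - τ) exp(-2 i π ω t)`, `z = τ + i ω`, as a Schwartz function. -/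
def atom (z : ℂ) : 𝓢(ℝ, ℂ) where
  toFun := atomFun z
  smooth' := contDiff_atomFun z
  decay' := fun k n => by
    obtain ⟨p, hp⟩ := iteratedDeriv_atomFun z n
    obtain ⟨C, hC⟩ := bounded_poly_mul_atomFun z (Polynomial.X ^ k * p)
    refine ⟨C, fun t => ?_⟩
    rw [norm_iteratedFDeriv_eq_norm_iteratedDeriv, hp]
    refine le_of_eq_of_le ?_ (hC t)
    simp [mul_assoc]

@[simp] lemma atom_apply (z : ℂ) (t : ℝ) : atom z t = atomFun z t := rfl

/-! ### Spectrogram -/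

/-- Short-time Fourier transform with Gaussian window of a tempered distribution `y`:
`y` is applied to the kernel `t ↦ g(t - τ) exp(-2 i π ω t)`, `z = τ + i ω`. -/
def stft (y : 𝓢'(ℝ, ℂ)) (z : ℂ) : ℂ := y (atom z)

/-- The spectrogram with Gaussian window. -/
def spec (y : 𝓢'(ℝ, ℂ)) (z : ℂ) : ℝ := ‖stft y z‖ ^ 2

/-! ### A pair of parallel linear chirps -/

/-- The signal `√γ₁ exp(2 i π t (a₁ + b t)) + √γ₂ exp(2 i π t (a₂ + b t))`. -/
def chirpPairFun (γ₁ γ₂ a₁ a₂ b : ℝ) (t : ℝ) : ℂ :=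
  Real.sqrt γ₁ * Complex.exp (2 * Complex.I * Real.pi * t * (a₁ + b * t)) +
    Real.sqrt γ₂ * Complex.exp (2 * Complex.I * Real.pi * t * (a₂ + b * t))

lemma norm_chirp (a b t : ℝ) :
    ‖Complex.exp (2 * Complex.I * Real.pi * t * (a + b * t))‖ = 1 := by
  have h : (2 * Complex.I * Real.pi * t * (a + b * t) : ℂ) =
      ((2 * Real.pi * t * (a + b * t) : ℝ) : ℂ) * Complex.I := by
    push_cast
    ring
  rw [h, Complex.norm_exp_ofReal_mul_I]

lemma memLp_chirpPairFun (γ₁ γ₂ a₁ a₂ b : ℝ) :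
    MeasureTheory.MemLp (chirpPairFun γ₁ γ₂ a₁ a₂ b) ⊤ MeasureTheory.volume := by
  refine MeasureTheory.memLp_top_of_bound ?_ (Real.sqrt γ₁ + Real.sqrt γ₂)
    (Filter.Eventually.of_forall fun t => ?_)
  · refine Continuous.aestronglyMeasurable ?_
    unfold chirpPairFun
    fun_prop
  · refine (norm_add_le _ _).trans (le_of_eq ?_)
    simp only [norm_mul, norm_chirp, mul_one, Complex.norm_real, Real.norm_eq_abs,
      abs_of_nonneg (Real.sqrt_nonneg _)]

/-- The pair of chirps as a tempered distribution, `φ ↦ ∫ x(t) φ(t) dt`. -/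
def chirpPair (γ₁ γ₂ a₁ a₂ b : ℝ) : 𝓢'(ℝ, ℂ) :=
  MeasureTheory.Lp.toTemperedDistribution
    (MeasureTheory.MemLp.toLp _ (memLp_chirpPairFun γ₁ γ₂ a₁ a₂ b))

/-- For the pair of chirps, `stft` is the usual integral `∫ x(t) g(t - τ) exp(-2 i π ω t) dt`. -/
lemma stft_chirpPair (γ₁ γ₂ a₁ a₂ b : ℝ) (z : ℂ) :
    stft (chirpPair γ₁ γ₂ a₁ a₂ b) z =
      ∫ t : ℝ, chirpPairFun γ₁ γ₂ a₁ a₂ b t *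
        ((window (t - z.re) : ℂ) * Complex.exp (-(2 * Complex.I * Real.pi * z.im * t))) := by
  rw [stft, chirpPair, MeasureTheory.Lp.toTemperedDistribution_apply]
  refine MeasureTheory.integral_congr_ae ?_
  filter_upwards [(memLp_chirpPairFun γ₁ γ₂ a₁ a₂ b).coeFn_toLp] with t ht
  rw [ht, smul_eq_mul, atom_apply, atomFun, mul_comm]

/-- `σ_b = √(2 / (1 + 4 b²))`. -/
def sigma (b : ℝ) : ℝ := Real.sqrt (2 / (1 + 4 * b ^ 2))

/-- The distance `a = σ_b (a₂ - a₁) / √2` between the lines `ω = a₁ + 2bτ` and `ω = a₂ + 2bτ`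
(signed, positive when `a₁ < a₂`). -/
def gap (a₁ a₂ b : ℝ) : ℝ := sigma b / Real.sqrt 2 * (a₂ - a₁)

/-- The coordinate `r = σ_b (ω - 2bτ - a₁) / √2` of `z = τ + i ω`, across the chirps. -/
def rCoord (a₁ b : ℝ) (z : ℂ) : ℝ := sigma b / Real.sqrt 2 * (z.im - 2 * b * z.re - a₁)

/-- The coordinate `s = σ_b (τ + 2bω - (a₁ + a₂) b) / √2` of `z = τ + i ω`, along the chirps. -/
def sCoord (a₁ a₂ b : ℝ) (z : ℂ) : ℝ :=
  sigma b / Real.sqrt 2 * (z.re + 2 * b * z.im - (a₁ + a₂) * b)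

/-- The rectangle `C_N` of the points whose coordinates satisfy
`(r, s) ∈ [0, a] × [N / a, (N + 1) / a]`. -/
def rect (a₁ a₂ b : ℝ) (N : ℕ) : Set ℂ :=
  {z | rCoord a₁ b z ∈ Set.Icc 0 (gap a₁ a₂ b) ∧
    sCoord a₁ a₂ b z ∈ Set.Icc (N / gap a₁ a₂ b) ((N + 1) / gap a₁ a₂ b)}

/-! ### White noise -/

/-- `ξ` is a complex white Gaussian noise on `ℝ`: a random tempered distribution with
characteristic functional `φ ↦ 𝔼 exp(i Re ⟨ξ, φ⟩) = exp(-‖φ‖²/4)`, the norm being that of `L²(ℝ)`.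
As `ξ` is complex linear in `φ`, this says that the variables `⟨ξ, φ⟩` are jointly circularly
symmetric complex Gaussian with `𝔼 |⟨ξ, φ⟩|² = ‖φ‖²`. -/
structure IsComplexWhiteNoise {Ω : Type*} [MeasurableSpace Ω] (P : MeasureTheory.Measure Ω)
    (ξ : Ω → 𝓢'(ℝ, ℂ)) : Prop where
  measurable_apply : ∀ φ : 𝓢(ℝ, ℂ), Measurable fun ω => ξ ω φ
  charFunctional : ∀ φ : 𝓢(ℝ, ℂ),
    ∫ ω, Complex.exp (Complex.I * ((ξ ω φ).re : ℂ)) ∂P =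
      (Real.exp (-(∫ t : ℝ, ‖φ t‖ ^ 2) / 4) : ℂ)

end

end NoisyChirps

open scoped SchwartzMap

namespace NoisyChirps

noncomputable section

open MeasureTheory ProbabilityTheory

/-! Up to a Gaussian factor, the short-time transform of a tempered distribution is an entire
function of the conjugate of `z`, its Bargmann transform (`hasDerivAt_bargmann`,
`stft_eq_bargmann`). Zeros of the spectrogram are therefore zeros of an entire function, and the
theorem is a Rouché comparison of signal and noise.

Signal. Take the isometric coordinate `ζ` centred at the middle of the rectangle and aligned with
the chirps. The transform of the pair is `p ζ * sinh (π a ζ)`, where `p` has no zeros and a Gaussian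
weighted modulus (`bargmann_chirpPair_conjPoint`). Its only zero in the rectangle is the centre.

Noise. Each value of the noise transform is a standard complex Gaussian, so `exp (9/20 |·|²)` has a
bounded mean. A sub-mean value inequality (`exp_fockNorm_le_lintegral`) turns an average over the
plane into bounds at all points, and Markov's inequality gives, off an event of probability at most
`ε / 4`, a squared modulus at most `64/25 * (log (4/ε) + K + 2 ‖ζ‖²)` everywhere
(`exists_noise_bound`).

Comparison. In the rectangle, wherever `‖sinh (π a ζ)‖ ≥ (4/5) sinh (π a² / 2)`, the signal exceeds
the noise (`noise_lt_signal`). The rectangle becomes long as `a → 0`, but there the quadratic growth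
of the noise is matched by that of `|sin (π a Im ζ)|²`. The remaining region is the image of a disc
under the inverse hyperbolic sine, and Rouché's theorem on the disc gives one zero
(`existsUnique_zero_of_perturbation`). As the noise bound is centred at the rectangle, the constant
obtained does not depend on `N`. -/

/-! ### Tempered distributions tested on entire functions -/

lemma iteratedDeriv_comp_ofReal {f : ℂ → ℂ} (hf : Differentiable ℂ f) (n : ℕ) :
    iteratedDeriv n (fun t : ℝ => f t) = fun t : ℝ => iteratedDeriv n f t := by
  induction n with
  | zero => simp
  | succ n ih =>
    rw [iteratedDeriv_succ, ih, iteratedDeriv_succ]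
    funext t
    have h : DifferentiableAt ℂ (iteratedDeriv n f) (t : ℂ) :=
      (hf.contDiff.differentiable_iteratedDeriv n (WithTop.coe_lt_top _)).differentiableAt
    exact h.hasDerivAt.comp_ofReal.deriv

/-- Cauchy's estimate on the unit circle about `t`, which stays in the strip; the exponential decay
then absorbs `|t| ^ k`. -/
lemma pow_mul_iteratedDeriv_le {f : ℂ → ℂ} (hf : Differentiable ℂ f) {D : ℝ}
    (hb : ∀ u : ℂ, |u.im| ≤ 1 → ‖f u‖ ≤ D * Real.exp (-‖u‖)) (k l : ℕ) (t : ℝ) :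
    |t| ^ k * ‖iteratedDeriv l (fun t : ℝ => f t) t‖ ≤
      k.factorial * l.factorial * Real.exp 1 * D := by
  have hD : 0 ≤ D := by
    have := (norm_nonneg _).trans (hb 0 (by simp))
    simpa using this
  rw [iteratedDeriv_comp_ofReal hf]
  have h1 : ‖iteratedDeriv l f t‖ ≤ l.factorial * (D * Real.exp (1 - |t|)) / 1 ^ l := by
    refine Complex.norm_iteratedDeriv_le_of_forall_mem_sphere_norm_le l one_pos
      hf.diffContOnCl fun u hu => ?_
    have hu' : ‖u - t‖ = 1 := by simpa [dist_eq_norm] using hu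
    refine (hb u ?_).trans ?_
    · have := Complex.abs_im_le_norm (u - t)
      simpa [hu'] using this
    · have : |t| ≤ ‖u‖ + 1 := by
        have := norm_sub_norm_le (t : ℂ) u
        rw [norm_sub_rev, hu', Complex.norm_real, Real.norm_eq_abs] at this
        linarith
      gcongr
      linarith
  have h2 : |t| ^ k ≤ k.factorial * Real.exp |t| := by
    have := Real.pow_div_factorial_le_exp |t| (abs_nonneg t) k
    rwa [div_le_iff₀ (by positivity), mul_comm] at this
  calc |t| ^ k * ‖iteratedDeriv l f t‖
      ≤ (k.factorial * Real.exp |t|) * (l.factorial * (D * Real.exp (1 - |t|)) / 1 ^ l) := by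
        gcongr
    _ = k.factorial * l.factorial * (Real.exp |t| * Real.exp (1 - |t|)) * D := by
        rw [one_pow]; ring
    _ = _ := by rw [← Real.exp_add]; ring_nf

/-- The Schwartz function which is the restriction to the real line of an entire function with
exponential decay in the strip `|Im u| ≤ 1`. -/
def schwartzOfEntire (f : ℂ → ℂ) (hf : Differentiable ℂ f) (D : ℝ)
    (hb : ∀ u : ℂ, |u.im| ≤ 1 → ‖f u‖ ≤ D * Real.exp (-‖u‖)) : 𝓢(ℝ, ℂ) where
  toFun t := f t
  smooth' := (hf.contDiff.restrict_scalars ℝ).comp Complex.ofRealCLM.contDiff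
  decay' k l := by
    refine ⟨k.factorial * l.factorial * Real.exp 1 * D, fun t => ?_⟩
    rw [norm_iteratedFDeriv_eq_norm_iteratedDeriv]
    exact pow_mul_iteratedDeriv_le hf hb k l t

/-- Continuity of `y` involves finitely many Schwartz seminorms, and Cauchy's estimate controls each
of them by the single number `D`. Estimates on kernels thus reduce to sup bounds in a strip. -/
lemma exists_bound_schwartz_entire (y : 𝓢'(ℝ, ℂ)) :
    ∃ C : ℝ, 0 ≤ C ∧ ∀ (φ : 𝓢(ℝ, ℂ)) (f : ℂ → ℂ) (D : ℝ), Differentiable ℂ f →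
      (∀ t : ℝ, φ t = f t) → (∀ u : ℂ, |u.im| ≤ 1 → ‖f u‖ ≤ D * Real.exp (-‖u‖)) →
      ‖y φ‖ ≤ C * D := by
  let q : Seminorm ℂ 𝓢(ℝ, ℂ) := (normSeminorm ℂ ℂ).comp y.toLinearMap
  have hq : Continuous q := continuous_norm.comp y.continuous
  obtain ⟨s, C, -, hC⟩ := Seminorm.bound_of_continuous (schwartz_withSeminorms ℂ ℝ ℂ) q hq
  let K : ℝ := ∑ p ∈ s, (p.1.factorial * p.2.factorial : ℝ)
  have hK : 0 ≤ K := Finset.sum_nonneg fun p _ => by positivity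
  refine ⟨C * (K * Real.exp 1), by positivity, fun φ f D hf hφ hb => ?_⟩
  have hD : 0 ≤ D := by
    have := (norm_nonneg _).trans (hb 0 (by simp))
    simpa using this
  have h1 : ‖y φ‖ ≤ C * (s.sup (schwartzSeminormFamily ℂ ℝ ℂ)) φ := hC φ
  have h2 : (s.sup (schwartzSeminormFamily ℂ ℝ ℂ)) φ ≤ K * Real.exp 1 * D := by
    refine Seminorm.finset_sup_apply_le (by positivity) fun p hp => ?_
    rw [SchwartzMap.schwartzSeminormFamily_apply]
    have h3 : (p.1.factorial * p.2.factorial : ℝ) ≤ K :=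
      Finset.single_le_sum (f := fun p : ℕ × ℕ => (p.1.factorial * p.2.factorial : ℝ))
        (fun p _ => by positivity) hp
    refine SchwartzMap.seminorm_le_bound' ℂ _ _ _ (by positivity) fun t => ?_
    have h4 : (φ : ℝ → ℂ) = fun t : ℝ => f t := funext hφ
    rw [h4]
    refine (pow_mul_iteratedDeriv_le hf hb _ _ t).trans ?_
    gcongr
  calc ‖y φ‖ ≤ C * (K * Real.exp 1 * D) := h1.trans (by gcongr)
    _ = _ := by ring

/-! ### The Bargmann transform and its holomorphy -/

/-- The holomorphic extension of the Gaussian window multiplied by `exp (2 π u w)`. -/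
def gaussExp (w u : ℂ) : ℂ :=
  ((2 : ℝ) ^ (1 / 4 : ℝ) : ℝ) * Complex.exp (-Real.pi * u ^ 2 + 2 * Real.pi * u * w)

lemma atomFun_eq (z : ℂ) (t : ℝ) :
    atomFun z t = Real.exp (-Real.pi * z.re ^ 2) * gaussExp (starRingEnd ℂ z) t := by
  have h : (starRingEnd ℂ z) = z.re - z.im * Complex.I := by
    apply Complex.ext <;> simp
  rw [atomFun, gaussExp, window, h]
  push_cast
  rw [mul_assoc, ← Complex.exp_add, mul_left_comm, ← Complex.exp_add]
  congr 2
  ring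

lemma quadratic_exp_bound (β x : ℝ) :
    Real.exp (-Real.pi * x ^ 2 + β * x) ≤ Real.exp (β ^ 2 / 4) := by
  have := Real.pi_gt_three
  gcongr
  nlinarith [sq_nonneg (x - β / 2), sq_nonneg x]

/-- `gaussExp` decays exponentially in the strip, with room for a factor `exp (β ‖u‖)`. -/
lemma norm_gaussExp_mul_le (β : ℝ) (w u : ℂ) (hu : |u.im| ≤ 1) :
    ‖gaussExp w u‖ * Real.exp (β * ‖u‖) ≤
      2 * Real.exp (2 * Real.pi + (2 * Real.pi * ‖w‖ + β + 1) ^ 2 / 4) * Real.exp (-‖u‖) := by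
  have h0 : (2 : ℝ) ^ (1 / 4 : ℝ) ≤ 2 := by
    have := Real.rpow_le_rpow_of_exponent_le (x := 2) (by norm_num) (show (1 / 4 : ℝ) ≤ 1 by norm_num)
    simpa using this
  have hre : (-Real.pi * u ^ 2 + 2 * Real.pi * u * w).re ≤
      -Real.pi * ‖u‖ ^ 2 + 2 * Real.pi + 2 * Real.pi * ‖w‖ * ‖u‖ := by
    have h1 : (u ^ 2).re = ‖u‖ ^ 2 - 2 * u.im ^ 2 := by
      rw [Complex.sq_norm, Complex.normSq_apply, pow_two u, Complex.mul_re]; ring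
    have h2 : (u * w).re ≤ ‖w‖ * ‖u‖ := by
      have := Complex.re_le_norm (u * w)
      rw [norm_mul] at this
      linarith
    have h3 : u.im ^ 2 ≤ 1 := (sq_le_one_iff_abs_le_one _).2 hu
    have h4 : (-Real.pi * u ^ 2 + 2 * Real.pi * u * w).re =
        -Real.pi * (u ^ 2).re + 2 * Real.pi * (u * w).re := by
      have : (-Real.pi * u ^ 2 + 2 * Real.pi * u * w : ℂ) =
        ((-Real.pi : ℝ) : ℂ) * u ^ 2 + ((2 * Real.pi : ℝ) : ℂ) * (u * w) := by push_cast; ring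
      rw [this, Complex.add_re, Complex.re_ofReal_mul, Complex.re_ofReal_mul]
    rw [h4, h1]
    nlinarith [Real.pi_pos]
  have h5 : ‖gaussExp w u‖ ≤ 2 * Real.exp (-Real.pi * ‖u‖ ^ 2 + 2 * Real.pi +
      2 * Real.pi * ‖w‖ * ‖u‖) := by
    rw [gaussExp, norm_mul, Complex.norm_exp]
    rw [Complex.norm_real, Real.norm_eq_abs, abs_of_nonneg (by positivity)]
    gcongr
  calc ‖gaussExp w u‖ * Real.exp (β * ‖u‖)
      ≤ 2 * Real.exp (-Real.pi * ‖u‖ ^ 2 + 2 * Real.pi +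
      2 * Real.pi * ‖w‖ * ‖u‖) * Real.exp (β * ‖u‖) := by gcongr
    _ = 2 * (Real.exp (2 * Real.pi) *
        Real.exp (-Real.pi * ‖u‖ ^ 2 + (2 * Real.pi * ‖w‖ + β + 1) * ‖u‖)) *
          Real.exp (-‖u‖) := by
        rw [← Real.exp_add, mul_assoc 2 (Real.exp _), ← Real.exp_add, mul_assoc 2 (Real.exp _),
          ← Real.exp_add]
        congr 2
        ring
    _ ≤ 2 * (Real.exp (2 * Real.pi) * Real.exp ((2 * Real.pi * ‖w‖ + β + 1) ^ 2 / 4)) *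
          Real.exp (-‖u‖) := by
        gcongr 2 * (_ * ?_) * _
        exact quadratic_exp_bound _ _
    _ = _ := by rw [← Real.exp_add]

lemma differentiable_gaussExp (w : ℂ) : Differentiable ℂ (gaussExp w) := by
  unfold gaussExp
  fun_prop

lemma norm_exp_sub_one_sub_le (x : ℂ) : ‖Complex.exp x - 1 - x‖ ≤ ‖x‖ ^ 2 * Real.exp ‖x‖ := by
  have := Complex.norm_exp_sub_sum_le_norm_mul_exp x 2
  simpa [Finset.sum_range_succ, sub_sub] using this

lemma norm_gaussExp_le (w u : ℂ) (hu : |u.im| ≤ 1) :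
    ‖gaussExp w u‖ ≤
      2 * Real.exp (2 * Real.pi + (2 * Real.pi * ‖w‖ + 0 + 1) ^ 2 / 4) * Real.exp (-‖u‖) := by
  simpa using norm_gaussExp_mul_le 0 w u hu

lemma norm_mul_gaussExp_le (w u : ℂ) (hu : |u.im| ≤ 1) :
    ‖2 * Real.pi * u * gaussExp w u‖ ≤
      2 * Real.pi * (2 * Real.exp (2 * Real.pi + (2 * Real.pi * ‖w‖ + 1 + 1) ^ 2 / 4)) *
        Real.exp (-‖u‖) := by
  have h1 := norm_gaussExp_mul_le 1 w u hu
  have h2 : ‖u‖ ≤ Real.exp (1 * ‖u‖) := by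
    have := Real.add_one_le_exp ‖u‖
    rw [one_mul]; linarith
  have h3 : ‖2 * Real.pi * u * gaussExp w u‖ = 2 * Real.pi * (‖gaussExp w u‖ * ‖u‖) := by
    simp [abs_of_pos Real.pi_pos]; ring
  rw [h3, mul_assoc (2 * Real.pi) _ (Real.exp (-‖u‖))]
  have h4 : ‖gaussExp w u‖ * ‖u‖ ≤ ‖gaussExp w u‖ * Real.exp (1 * ‖u‖) := by gcongr
  have := Real.pi_pos
  exact mul_le_mul_of_nonneg_left (h4.trans h1) (by positivity)

/-- The kernel of the Bargmann transform, as a Schwartz function. -/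
def bargmannKernel (w : ℂ) : 𝓢(ℝ, ℂ) :=
  schwartzOfEntire (gaussExp w) (differentiable_gaussExp w) _ (norm_gaussExp_le w)

/-- The derivative of `bargmannKernel` with respect to its parameter. -/
def bargmannKernelDeriv (w : ℂ) : 𝓢(ℝ, ℂ) :=
  schwartzOfEntire (fun u => 2 * Real.pi * u * gaussExp w u)
    (by have := differentiable_gaussExp w; fun_prop) _ (norm_mul_gaussExp_le w)

/-- The Bargmann transform of a tempered distribution. -/
def bargmann (y : 𝓢'(ℝ, ℂ)) (w : ℂ) : ℂ := y (bargmannKernel w)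

lemma gaussExp_add (w h u : ℂ) :
    gaussExp (w + h) u = gaussExp w u * Complex.exp (2 * Real.pi * u * h) := by
  rw [gaussExp, gaussExp, mul_assoc _ (Complex.exp _), ← Complex.exp_add]
  congr 2
  ring

/-- The Taylor remainder of `exp (2 π u h)` costs a factor `‖u‖² exp (2 π ‖u‖)`, at most `2 exp ((2
π + 1) ‖u‖)`, which the Gaussian decay absorbs. The bound is quadratic in `h`, as differentiability
requires. -/
lemma norm_gaussExp_remainder_le (w h u : ℂ) (hh : ‖h‖ ≤ 1) (hu : |u.im| ≤ 1) :
    ‖gaussExp (w + h) u - gaussExp w u - h * (2 * Real.pi * u * gaussExp w u)‖ ≤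
      (2 * Real.pi) ^ 2 * 2 * (2 * Real.exp (2 * Real.pi +
        (2 * Real.pi * ‖w‖ + (2 * Real.pi + 1) + 1) ^ 2 / 4)) * ‖h‖ ^ 2 * Real.exp (-‖u‖) := by
  have h1 := norm_gaussExp_mul_le (2 * Real.pi + 1) w u hu
  have h2 : gaussExp (w + h) u - gaussExp w u - h * (2 * Real.pi * u * gaussExp w u) =
      gaussExp w u * (Complex.exp (2 * Real.pi * u * h) - 1 - 2 * Real.pi * u * h) := by
    rw [gaussExp_add]; ring
  have h3 : ‖(2 * Real.pi * u * h : ℂ)‖ = 2 * Real.pi * ‖u‖ * ‖h‖ := by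
    simp [abs_of_pos Real.pi_pos]
  have h4 : ‖u‖ ^ 2 ≤ 2 * Real.exp ‖u‖ := by
    have := Real.pow_div_factorial_le_exp ‖u‖ (norm_nonneg u) 2
    rw [div_le_iff₀ (by positivity)] at this
    simpa [mul_comm] using this
  have hpi := Real.pi_pos
  rw [h2, norm_mul]
  calc ‖gaussExp w u‖ * ‖Complex.exp (2 * Real.pi * u * h) - 1 - 2 * Real.pi * u * h‖
      ≤ ‖gaussExp w u‖ * ((2 * Real.pi * ‖u‖ * ‖h‖) ^ 2 * Real.exp (2 * Real.pi * ‖u‖ * ‖h‖)) := by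
        gcongr
        rw [← h3]
        exact norm_exp_sub_one_sub_le _
    _ ≤ ‖gaussExp w u‖ * ((2 * Real.pi) ^ 2 * (2 * Real.exp ‖u‖) * ‖h‖ ^ 2 *
          Real.exp (2 * Real.pi * ‖u‖)) := by
        rw [mul_pow, mul_pow]
        have h5 : 2 * Real.pi * ‖u‖ * ‖h‖ ≤ 2 * Real.pi * ‖u‖ :=
          mul_le_of_le_one_right (by positivity) hh
        gcongr
    _ = (2 * Real.pi) ^ 2 * 2 * ‖h‖ ^ 2 *
          (‖gaussExp w u‖ * Real.exp ((2 * Real.pi + 1) * ‖u‖)) := by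
        rw [add_mul, Real.exp_add, one_mul]; ring
    _ ≤ (2 * Real.pi) ^ 2 * 2 * ‖h‖ ^ 2 * (2 * Real.exp (2 * Real.pi +
        (2 * Real.pi * ‖w‖ + (2 * Real.pi + 1) + 1) ^ 2 / 4) * Real.exp (-‖u‖)) := by gcongr
    _ = _ := by ring

theorem hasDerivAt_bargmann (y : 𝓢'(ℝ, ℂ)) (w : ℂ) :
    HasDerivAt (bargmann y) (y (bargmannKernelDeriv w)) w := by
  obtain ⟨C, hC0, hC⟩ := exists_bound_schwartz_entire y
  rw [hasDerivAt_iff_isLittleO_nhds_zero]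
  refine Asymptotics.IsBigO.trans_isLittleO (g := fun h : ℂ => h ^ 2) ?_ ?_
  · refine Asymptotics.IsBigO.of_bound (C * ((2 * Real.pi) ^ 2 * 2 * (2 * Real.exp (2 * Real.pi +
        (2 * Real.pi * ‖w‖ + (2 * Real.pi + 1) + 1) ^ 2 / 4)))) ?_
    filter_upwards [Metric.closedBall_mem_nhds (0 : ℂ) one_pos] with h hh
    have hh' : ‖h‖ ≤ 1 := by simpa using hh
    have h1 : bargmann y (w + h) - bargmann y w - h • y (bargmannKernelDeriv w) =
        y (bargmannKernel (w + h) - bargmannKernel w - h • bargmannKernelDeriv w) := by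
      simp [bargmann, map_sub, map_smul]
    rw [h1, norm_pow, mul_assoc]
    refine hC _ (fun u => gaussExp (w + h) u - gaussExp w u - h * (2 * Real.pi * u * gaussExp w u))
      _ ?_ (fun t => ?_) fun u hu => norm_gaussExp_remainder_le w h u hh' hu
    · have := differentiable_gaussExp w
      have := differentiable_gaussExp (w + h)
      fun_prop
    · rfl
  · simpa using Asymptotics.isLittleO_pow_id (𝕜 := ℂ) (n := 2) (by norm_num)

lemma differentiable_bargmann (y : 𝓢'(ℝ, ℂ)) : Differentiable ℂ (bargmann y) :=
  fun w => (hasDerivAt_bargmann y w).differentiableAt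

theorem stft_eq_bargmann (y : 𝓢'(ℝ, ℂ)) (z : ℂ) :
    stft y z = Real.exp (-Real.pi * z.re ^ 2) * bargmann y (starRingEnd ℂ z) := by
  have h : atom z = (Real.exp (-Real.pi * z.re ^ 2) : ℂ) • bargmannKernel (starRingEnd ℂ z) := by
    ext t
    rw [atom_apply, atomFun_eq, smul_apply, smul_eq_mul]
    simp only [Complex.ofReal_exp]
    rfl
  rw [stft, h, map_smul, bargmann, smul_eq_mul]

/-! ### Sub-mean value inequality in the Fock space -/

/-- Mean value property of entire functions on discs. -/
lemma setIntegral_ball_of_differentiable {G : ℂ → ℂ} (hG : Differentiable ℂ G) (c : ℂ) {R : ℝ}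
    (hR : 0 ≤ R) : ∫ w in Metric.ball c R, G w = (Real.pi * R ^ 2 : ℝ) • G c := by
  have h1 : ∫ w in Metric.ball c R, G w =
      ∫ w, (Metric.ball (0 : ℂ) R).indicator (fun w => G (w + c)) w := by
    rw [← integral_indicator Metric.isOpen_ball.measurableSet,
      ← integral_add_right_eq_self _ c]
    refine integral_congr_ae (Filter.Eventually.of_forall fun w => ?_)
    by_cases hw : w ∈ Metric.ball (0 : ℂ) R
    · have : w + c ∈ Metric.ball c R := by simpa [dist_eq_norm] using hw
      simp only [Set.indicator_of_mem hw, Set.indicator_of_mem this]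
    · have : w + c ∉ Metric.ball c R := by simpa [dist_eq_norm] using hw
      simp only [Set.indicator_of_notMem hw, Set.indicator_of_notMem this]
  have h2 : ∫ p in polarCoord.target, p.1 • (Metric.ball (0 : ℂ) R).indicator
        (fun w => G (w + c)) (Complex.polarCoord.symm p) =
      ∫ p in Set.Ioo 0 R ×ˢ Set.Ioo (-Real.pi) Real.pi,
        p.1 • G (Complex.polarCoord.symm p + c) := by
    have hs : Set.Ioo 0 R ×ˢ Set.Ioo (-Real.pi) Real.pi ⊆ polarCoord.target := by
      rintro ⟨r, θ⟩ ⟨hr, hθ⟩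
      exact ⟨hr.1, hθ⟩
    rw [← integral_indicator polarCoord.open_target.measurableSet,
      ← integral_indicator (measurableSet_Ioo.prod measurableSet_Ioo)]
    refine integral_congr_ae (Filter.Eventually.of_forall fun p => ?_)
    by_cases hp : p ∈ polarCoord.target
    · simp only [Set.indicator_of_mem hp]
      have hp1 : 0 < p.1 := hp.1
      by_cases hr : p.1 < R
      · have h3 : p ∈ Set.Ioo 0 R ×ˢ Set.Ioo (-Real.pi) Real.pi := ⟨⟨hp1, hr⟩, hp.2⟩
        have h4 : Complex.polarCoord.symm p ∈ Metric.ball (0 : ℂ) R := by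
          rw [mem_ball_zero_iff, Complex.norm_polarCoord_symm, abs_of_pos hp1]
          exact hr
        simp only [Set.indicator_of_mem h3, Set.indicator_of_mem h4]
      · have h3 : p ∉ Set.Ioo 0 R ×ˢ Set.Ioo (-Real.pi) Real.pi := fun h => hr h.1.2
        have h4 : Complex.polarCoord.symm p ∉ Metric.ball (0 : ℂ) R := by
          rw [mem_ball_zero_iff, Complex.norm_polarCoord_symm, abs_of_pos hp1]
          exact hr
        simp only [Set.indicator_of_notMem h3, Set.indicator_of_notMem h4, smul_zero]
    · have h3 : p ∉ Set.Ioo 0 R ×ˢ Set.Ioo (-Real.pi) Real.pi := fun h => hp (hs h)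
      simp only [Set.indicator_of_notMem hp, Set.indicator_of_notMem h3]
  have hcont : Continuous fun p : ℝ × ℝ => p.1 • G (Complex.polarCoord.symm p + c) := by
    have := hG.continuous
    simp only [Complex.polarCoord_symm_apply]
    fun_prop
  have h3 : ∀ r : ℝ, ∫ θ in Set.Ioo (-Real.pi) Real.pi,
      r • G (Complex.polarCoord.symm (r, θ) + c) = r • (2 * Real.pi) • G c := by
    intro r
    have h4 := (hG.diffContOnCl (s := Metric.ball c |r|)).circleAverage
    rw [Real.circleAverage_def, inv_smul_eq_iff₀ (by positivity)] at h4
    have h5 : (fun θ => G (circleMap c r θ)).Periodic (2 * Real.pi) :=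
      fun θ => congrArg G (periodic_circleMap c r θ)
    have h6 := h5.intervalIntegral_add_eq 0 (-Real.pi)
    rw [zero_add, h4, show -Real.pi + 2 * Real.pi = Real.pi by ring,
      intervalIntegral.integral_of_le (by linarith [Real.pi_pos]),
      integral_Ioc_eq_integral_Ioo] at h6
    rw [integral_smul, h6]
    congr 1
    refine integral_congr_ae (Filter.Eventually.of_forall fun θ => ?_)
    simp only [Complex.polarCoord_symm_apply, circleMap, Complex.exp_mul_I]
    push_cast
    rw [add_comm]
  have hint : IntegrableOn (fun p : ℝ × ℝ => p.1 • G (Complex.polarCoord.symm p + c))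
      (Set.Ioo 0 R ×ˢ Set.Ioo (-Real.pi) Real.pi) (volume.prod volume) :=
    (hcont.continuousOn.integrableOn_compact
      (isCompact_Icc.prod isCompact_Icc : IsCompact (Set.Icc 0 R ×ˢ Set.Icc (-Real.pi) Real.pi))).mono_set
      (Set.prod_mono Set.Ioo_subset_Icc_self Set.Ioo_subset_Icc_self)
  rw [h1, ← Complex.integral_comp_polarCoord_symm, h2, Measure.volume_eq_prod,
    setIntegral_prod _ hint]
  simp_rw [h3]
  rw [integral_smul_const, ← integral_Ioc_eq_integral_Ioo, ← intervalIntegral.integral_of_le hR,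
    integral_id, smul_smul]
  congr 1
  ring

lemma lintegral_ball_ge {G : ℂ → ℂ} (hG : Differentiable ℂ G) {p : ℂ → ℝ} (hp : Continuous p)
    (c : ℂ) {R : ℝ} (hR : 0 ≤ R) (hp0 : ∀ w, 0 ≤ p w)
    (hle : ∀ w ∈ Metric.ball c R, (G w).re ≤ p w) :
    ENNReal.ofReal (Real.pi * R ^ 2 * (G c).re) ≤
      ∫⁻ w in Metric.ball c R, ENNReal.ofReal (p w) := by
  have hc : ∀ {E : Type} [NormedAddCommGroup E] {f : ℂ → E}, Continuous f →
      IntegrableOn f (Metric.ball c R) := fun hf =>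
    (hf.continuousOn.integrableOn_compact (isCompact_closedBall c R)).mono_set
      Metric.ball_subset_closedBall
  rw [← ofReal_integral_eq_lintegral_ofReal (hc hp) (Filter.Eventually.of_forall hp0)]
  refine ENNReal.ofReal_le_ofReal ?_
  have h1 := congrArg Complex.re (setIntegral_ball_of_differentiable hG c hR)
  have h2 : (∫ w in Metric.ball c R, G w).re = ∫ w in Metric.ball c R, (G w).re :=
    (Complex.reCLM.integral_comp_comm (hc hG.continuous)).symm
  rw [h2, Complex.smul_re, smul_eq_mul] at h1
  rw [← h1]
  exact setIntegral_mono_on (hc (Complex.continuous_re.comp hG.continuous)) (hc hp)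
    Metric.isOpen_ball.measurableSet hle

/-- The Gaussian weight turning the squared modulus of an entire function into a spectrogram. -/
def fockNorm (Y : ℂ → ℂ) (w : ℂ) : ℝ := Real.exp (-Real.pi * w.re ^ 2) * ‖Y w‖

lemma continuous_fockNorm {Y : ℂ → ℂ} (hY : Continuous Y) : Continuous (fockNorm Y) := by
  unfold fockNorm; fun_prop

/-- The function `π/2 ‖w - c‖² - π (Re w)²` is harmonic, hence the real part of a polynomial, whose
exponential multiplies `Y`. The two sides agree with `fockNorm` at `c`. -/
lemma exists_entire_norm_eq_fockNorm {Y : ℂ → ℂ} (hY : Differentiable ℂ Y) (c : ℂ) :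
    ∃ H : ℂ → ℂ, Differentiable ℂ H ∧
      ∀ w, ‖H w‖ = fockNorm Y w * Real.exp (Real.pi / 2 * ‖w - c‖ ^ 2) := by
  refine ⟨fun w => Y w * Complex.exp (-(Real.pi / 2 : ℝ) * w ^ 2 -
    (Real.pi : ℝ) * (w * starRingEnd ℂ c) + (Real.pi / 2 * ‖c‖ ^ 2 : ℝ)), by fun_prop, fun w => ?_⟩
  rw [norm_mul, Complex.norm_exp, fockNorm, mul_comm _ ‖Y w‖, mul_assoc, ← Real.exp_add]
  congr 2
  rw [Complex.sq_norm, Complex.sq_norm, Complex.normSq_apply, Complex.normSq_apply, pow_two w]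
  rw [← Complex.ofReal_neg, Complex.add_re, Complex.sub_re, Complex.re_ofReal_mul,
    Complex.re_ofReal_mul, Complex.ofReal_re]
  simp only [Complex.mul_re, Complex.conj_re, Complex.conj_im, Complex.sub_re, Complex.sub_im]
  ring

/-- Sub-mean value property of `exp (l ‖Y‖²)` in the Fock space. -/
theorem exp_fockNorm_le_lintegral {Y : ℂ → ℂ} (hY : Differentiable ℂ Y) (c : ℂ) {R l : ℝ}
    (hR : 0 ≤ R) (hl : 0 ≤ l) :
    ENNReal.ofReal (Real.pi * R ^ 2 *
        Real.exp (l * Real.exp (-Real.pi * R ^ 2) * fockNorm Y c ^ 2)) ≤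
      ∫⁻ w in Metric.ball c R, ENNReal.ofReal (Real.exp (l * fockNorm Y w ^ 2)) := by
  obtain ⟨H, hH, hnorm⟩ := exists_entire_norm_eq_fockNorm hY c
  set l' := l * Real.exp (-Real.pi * R ^ 2) with hl'
  have hl0 : 0 ≤ l' := by positivity
  -- The real part of `G` is a minorant of `exp (l' ‖H‖²)` touching it at `c`: both `exp` and the
  -- squared norm are replaced by their tangents, by convexity. The mean value equality for `G` then
  -- suffices.
  let G : ℂ → ℂ := fun w => (Real.exp (l' * ‖H c‖ ^ 2) : ℝ) *
    (1 + (2 * l' : ℝ) * (starRingEnd ℂ (H c) * (H w - H c)))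
  have hGc : (G c).re = Real.exp (l' * fockNorm Y c ^ 2) := by
    have : ‖H c‖ = fockNorm Y c := by simpa using hnorm c
    simp only [G, Complex.re_ofReal_mul, this]
    simp
  rw [← hGc]
  refine lintegral_ball_ge (by fun_prop) ?_ c hR (fun w => (Real.exp_pos _).le) fun w hw => ?_
  · have := continuous_fockNorm hY.continuous
    fun_prop
  · have h1 : l' * ‖H w‖ ^ 2 ≤ l * fockNorm Y w ^ 2 := by
      have h2 : ‖w - c‖ ^ 2 ≤ R ^ 2 := by
        have : ‖w - c‖ < R := by simpa [dist_eq_norm] using hw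
        gcongr
      have h3 : Real.exp (-Real.pi * R ^ 2) * Real.exp (Real.pi * ‖w - c‖ ^ 2) ≤ 1 := by
        rw [← Real.exp_add, Real.exp_le_one_iff]
        nlinarith [Real.pi_pos]
      have h4 : ‖H w‖ ^ 2 = fockNorm Y w ^ 2 * Real.exp (Real.pi * ‖w - c‖ ^ 2) := by
        rw [hnorm, mul_pow, ← Real.exp_nat_mul]
        congr 2
        push_cast; ring
      calc l' * ‖H w‖ ^ 2 = l * fockNorm Y w ^ 2 *
            (Real.exp (-Real.pi * R ^ 2) * Real.exp (Real.pi * ‖w - c‖ ^ 2)) := by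
            rw [h4, hl']; ring
        _ ≤ l * fockNorm Y w ^ 2 * 1 := by gcongr
        _ = _ := mul_one _
    have h5 : 2 * (starRingEnd ℂ (H c) * (H w - H c)).re ≤ ‖H w‖ ^ 2 - ‖H c‖ ^ 2 := by
      rw [Complex.sq_norm, Complex.sq_norm, Complex.normSq_apply, Complex.normSq_apply]
      simp only [Complex.mul_re, Complex.conj_re, Complex.conj_im, Complex.sub_re, Complex.sub_im]
      nlinarith [sq_nonneg ((H w).re - (H c).re), sq_nonneg ((H w).im - (H c).im)]
    have h6 : (G w).re = Real.exp (l' * ‖H c‖ ^ 2) *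
        (1 + l' * (2 * (starRingEnd ℂ (H c) * (H w - H c)).re)) := by
      simp only [G, Complex.re_ofReal_mul, Complex.add_re, Complex.one_re]
      ring
    rw [h6]
    calc _ ≤ Real.exp (l' * ‖H c‖ ^ 2) * (1 + l' * (‖H w‖ ^ 2 - ‖H c‖ ^ 2)) := by gcongr
      _ ≤ Real.exp (l' * ‖H c‖ ^ 2) * Real.exp (l' * (‖H w‖ ^ 2 - ‖H c‖ ^ 2)) := by
          gcongr
          rw [add_comm]
          exact Real.add_one_le_exp _
      _ = Real.exp (l' * ‖H w‖ ^ 2) := by rw [← Real.exp_add]; ring_nf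
      _ ≤ _ := by gcongr

/-! ### Uniform bound on the spectrogram of white noise -/

lemma norm_stft_eq_fockNorm (y : 𝓢'(ℝ, ℂ)) (z : ℂ) :
    ‖stft y z‖ = fockNorm (bargmann y) (starRingEnd ℂ z) := by
  rw [stft_eq_bargmann, norm_mul, Complex.norm_real, Real.norm_eq_abs, Real.abs_exp, fockNorm,
    Complex.conj_re]

lemma integral_norm_atom_sq (z : ℂ) : ∫ t : ℝ, ‖atom z t‖ ^ 2 = 1 := by
  have h1 : ∀ t : ℝ, ‖atom z t‖ ^ 2 = Real.sqrt 2 * Real.exp (-(2 * Real.pi) * (t - z.re) ^ 2) := by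
    intro t
    rw [atom_apply, norm_atomFun, mul_pow, ← Real.exp_nat_mul, ← Real.rpow_natCast,
      ← Real.rpow_mul (by norm_num), Real.sqrt_eq_rpow]
    congr 2 <;> push_cast <;> ring
  simp_rw [h1]
  rw [integral_const_mul, integral_sub_right_eq_self (fun t => Real.exp (-(2 * Real.pi) * t ^ 2)),
    integral_gaussian, ← Real.sqrt_mul (by norm_num),
    show 2 * (Real.pi / (2 * Real.pi)) = 1 by field_simp, Real.sqrt_one]

section

variable {Ω : Type*} [MeasurableSpace Ω] {P : Measure Ω} {ξ : Ω → 𝓢'(ℝ, ℂ)}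

lemma IsComplexWhiteNoise.map_re [IsProbabilityMeasure P] (h : IsComplexWhiteNoise P ξ)
    (φ : 𝓢(ℝ, ℂ)) (hφ : ∫ t : ℝ, ‖φ t‖ ^ 2 = 1) :
    P.map (fun ω => (ξ ω φ).re) = gaussianReal 0 (1 / 2) := by
  have hm : Measurable fun ω => (ξ ω φ).re := Complex.measurable_re.comp (h.measurable_apply φ)
  have : IsProbabilityMeasure (P.map (fun ω => (ξ ω φ).re)) :=
    Measure.isProbabilityMeasure_map hm.aemeasurable
  refine Measure.ext_of_charFun ?_
  funext t
  rw [charFun_apply_real, charFun_gaussianReal, integral_map hm.aemeasurable (by fun_prop)]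
  have h1 := h.charFunctional ((t : ℂ) • φ)
  have h2 : ∫ s : ℝ, ‖((t : ℂ) • φ) s‖ ^ 2 = t ^ 2 := by
    simp only [smul_apply, norm_smul, Complex.norm_real, mul_pow, Real.norm_eq_abs, sq_abs]
    rw [integral_const_mul, hφ, mul_one]
  rw [h2] at h1
  simp only [map_smul, smul_eq_mul, Complex.re_ofReal_mul] at h1
  convert h1 using 1
  · refine integral_congr_ae (Filter.Eventually.of_forall fun ω => ?_)
    simp only
    congr 1
    push_cast
    ring
  · rw [Complex.ofReal_exp]
    congr 1
    push_cast
    ring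

lemma IsComplexWhiteNoise.map_im [IsProbabilityMeasure P] (h : IsComplexWhiteNoise P ξ)
    (φ : 𝓢(ℝ, ℂ)) (hφ : ∫ t : ℝ, ‖φ t‖ ^ 2 = 1) :
    P.map (fun ω => (ξ ω φ).im) = gaussianReal 0 (1 / 2) := by
  -- The imaginary part at `φ` is the real part at `-i φ`.
  rw [← h.map_re (-Complex.I • φ) (by simpa [smul_apply, norm_smul] using hφ)]
  congr 1
  funext ω
  simp

/-- The moment `𝔼 exp (0.9 X²)` of a Gaussian variable of variance `1 / 2`. -/
def gaussSqMoment : ENNReal :=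
  ∫⁻ x, ENNReal.ofReal (Real.exp (9 / 10 * x ^ 2)) ∂(gaussianReal 0 (1 / 2))

lemma gaussSqMoment_lt_top : gaussSqMoment < ⊤ := by
  rw [gaussSqMoment, gaussianReal_of_var_ne_zero _ (by norm_num),
    lintegral_withDensity_eq_lintegral_mul _ (measurable_gaussianPDF _ _) (by fun_prop)]
  have h : Integrable (fun x : ℝ => (Real.sqrt (2 * Real.pi * (1 / 2 : NNReal)))⁻¹ *
      Real.exp (-(1 / 10) * x ^ 2)) :=
    (integrable_exp_neg_mul_sq (by norm_num)).const_mul _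
  refine lt_of_eq_of_lt (lintegral_congr fun x => ?_) h.lintegral_lt_top
  rw [Pi.mul_apply, gaussianPDF, gaussianPDFReal, ← ENNReal.ofReal_mul (by positivity), mul_assoc,
    ← Real.exp_add]
  congr 3
  push_cast
  ring

/-- Bounding `‖·‖²` by twice the larger of the two squares avoids any independence of real and
imaginary parts. The resulting exponent `9/10` is below `1`, so it is integrable against the density
proportional to `exp (-x²)`. -/
lemma IsComplexWhiteNoise.lintegral_exp_norm_sq_le [IsProbabilityMeasure P]
    (h : IsComplexWhiteNoise P ξ) (φ : 𝓢(ℝ, ℂ)) (hφ : ∫ t : ℝ, ‖φ t‖ ^ 2 = 1) :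
    ∫⁻ ω, ENNReal.ofReal (Real.exp (9 / 20 * ‖ξ ω φ‖ ^ 2)) ∂P ≤ 2 * gaussSqMoment := by
  have hre : ∫⁻ ω, ENNReal.ofReal (Real.exp (9 / 10 * (ξ ω φ).re ^ 2)) ∂P = gaussSqMoment := by
    rw [gaussSqMoment, ← h.map_re φ hφ, lintegral_map (by fun_prop)
      (show Measurable fun ω => (ξ ω φ).re from
        Complex.measurable_re.comp (h.measurable_apply φ))]
  have him : ∫⁻ ω, ENNReal.ofReal (Real.exp (9 / 10 * (ξ ω φ).im ^ 2)) ∂P = gaussSqMoment := by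
    rw [gaussSqMoment, ← h.map_im φ hφ, lintegral_map (by fun_prop)
      (show Measurable fun ω => (ξ ω φ).im from
        Complex.measurable_im.comp (h.measurable_apply φ))]
  rw [two_mul]
  nth_rewrite 1 [← hre]
  rw [← him, ← lintegral_add_left]
  · refine lintegral_mono fun ω => ?_
    rw [← ENNReal.ofReal_add (by positivity) (by positivity)]
    refine ENNReal.ofReal_le_ofReal ?_
    rw [Complex.sq_norm, Complex.normSq_apply]
    rcases le_total ((ξ ω φ).re ^ 2) ((ξ ω φ).im ^ 2) with h1 | h1
    · refine le_add_of_nonneg_of_le (Real.exp_pos _).le (Real.exp_le_exp.2 ?_)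
      linarith
    · refine le_add_of_le_of_nonneg (Real.exp_le_exp.2 ?_) (Real.exp_pos _).le
      linarith
  · have := h.measurable_apply φ
    fun_prop

/-- A Gaussian average of `exp (0.45 Spec(ξ))`. -/
def expSpecAverage (y : 𝓢'(ℝ, ℂ)) (c : ℂ) : ENNReal :=
  ∫⁻ w, ENNReal.ofReal (Real.exp (-‖w - c‖ ^ 2)) *
    ENNReal.ofReal (Real.exp (9 / 20 * fockNorm (bargmann y) w ^ 2))

lemma IsComplexWhiteNoise.measurable_uncurry (h : IsComplexWhiteNoise P ξ) :
    Measurable (Function.uncurry fun (w : ℂ) (ω : Ω) => fockNorm (bargmann (ξ ω)) w) := by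
  refine measurable_uncurry_of_continuous_of_measurable
    (fun ω => continuous_fockNorm (differentiable_bargmann (ξ ω)).continuous) fun w => ?_
  exact (h.measurable_apply _).norm.const_mul _

lemma IsComplexWhiteNoise.measurable_expSpecAverage (h : IsComplexWhiteNoise P ξ) (c : ℂ) :
    Measurable fun ω => expSpecAverage (ξ ω) c := by
  have h1 : Measurable fun p : Ω × ℂ => fockNorm (bargmann (ξ p.1)) p.2 :=
    h.measurable_uncurry.comp measurable_swap
  unfold expSpecAverage
  refine Measurable.lintegral_prod_right' (f := fun p : Ω × ℂ =>
    ENNReal.ofReal (Real.exp (-‖p.2 - c‖ ^ 2)) *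
    ENNReal.ofReal (Real.exp (9 / 20 * fockNorm (bargmann (ξ p.1)) p.2 ^ 2))) ?_
  fun_prop

/-- The total mass of the Gaussian weight on the plane. -/
def planeGaussMass : ENNReal := ∫⁻ w : ℂ, ENNReal.ofReal (Real.exp (-‖w‖ ^ 2))

lemma planeGaussMass_lt_top : planeGaussMass < ⊤ := by
  have h := (GaussianFourier.integrable_cexp_neg_mul_sq_norm_add (V := ℂ) (b := 1) (by simp) 0 0).norm
  refine lt_of_eq_of_lt (lintegral_congr fun w => ?_) h.lintegral_lt_top
  congr 1
  simp [Complex.norm_exp, ← Complex.ofReal_pow]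

/-- By Tonelli, since every atom has unit norm and the moment bound is the same at each point; the
bound is uniform in `c`. -/
lemma IsComplexWhiteNoise.lintegral_expSpecAverage_le [IsProbabilityMeasure P]
    (h : IsComplexWhiteNoise P ξ) (c : ℂ) :
    ∫⁻ ω, expSpecAverage (ξ ω) c ∂P ≤ planeGaussMass * (2 * gaussSqMoment) := by
  have h1 : Measurable fun p : Ω × ℂ => fockNorm (bargmann (ξ p.1)) p.2 :=
    h.measurable_uncurry.comp measurable_swap
  unfold expSpecAverage
  rw [lintegral_lintegral_swap]
  · have h2 : ∀ w : ℂ, ∫⁻ ω, ENNReal.ofReal (Real.exp (-‖w - c‖ ^ 2)) *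
        ENNReal.ofReal (Real.exp (9 / 20 * fockNorm (bargmann (ξ ω)) w ^ 2)) ∂P ≤
        ENNReal.ofReal (Real.exp (-‖w - c‖ ^ 2)) * (2 * gaussSqMoment) := by
      intro w
      rw [lintegral_const_mul' _ _ ENNReal.ofReal_ne_top]
      gcongr
      refine le_of_eq_of_le (lintegral_congr fun ω => ?_)
        (h.lintegral_exp_norm_sq_le (atom (starRingEnd ℂ w)) (integral_norm_atom_sq _))
      rw [← Complex.conj_conj w, ← norm_stft_eq_fockNorm, Complex.conj_conj]
      rfl
    refine (lintegral_mono h2).trans (le_of_eq ?_)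
    rw [lintegral_mul_const _ (by fun_prop), planeGaussMass,
      lintegral_sub_right_eq_self (fun w : ℂ => ENNReal.ofReal (Real.exp (-‖w‖ ^ 2)))]
  · refine Measurable.aemeasurable ?_
    unfold Function.uncurry
    fun_prop

end

/-- On the ball about `w` the weight is at least `exp (-2 ‖w - c‖² - 2 R²)`; its logarithm is the
source of the quadratic growth in the noise bound. -/
lemma exp_spec_le_expSpecAverage (y : 𝓢'(ℝ, ℂ)) (c w : ℂ) {R : ℝ} (hR : 0 ≤ R) :
    ENNReal.ofReal (Real.exp (-(2 * ‖w - c‖ ^ 2 + 2 * R ^ 2)) * (Real.pi * R ^ 2 *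
      Real.exp (9 / 20 * Real.exp (-Real.pi * R ^ 2) * fockNorm (bargmann y) w ^ 2))) ≤
      expSpecAverage y c := by
  rw [ENNReal.ofReal_mul (by positivity)]
  calc _ ≤ ENNReal.ofReal (Real.exp (-(2 * ‖w - c‖ ^ 2 + 2 * R ^ 2))) *
        ∫⁻ v in Metric.ball w R,
          ENNReal.ofReal (Real.exp (9 / 20 * fockNorm (bargmann y) v ^ 2)) := by
        gcongr
        exact exp_fockNorm_le_lintegral (differentiable_bargmann y) w hR (by norm_num)
    _ = ∫⁻ v in Metric.ball w R, ENNReal.ofReal (Real.exp (-(2 * ‖w - c‖ ^ 2 + 2 * R ^ 2))) *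
          ENNReal.ofReal (Real.exp (9 / 20 * fockNorm (bargmann y) v ^ 2)) := by
        rw [lintegral_const_mul' _ _ ENNReal.ofReal_ne_top]
    _ ≤ ∫⁻ v in Metric.ball w R, ENNReal.ofReal (Real.exp (-‖v - c‖ ^ 2)) *
          ENNReal.ofReal (Real.exp (9 / 20 * fockNorm (bargmann y) v ^ 2)) := by
        refine setLIntegral_mono' Metric.isOpen_ball.measurableSet fun v hv => ?_
        gcongr
        have h1 : ‖v - w‖ ≤ R := by
          have : ‖v - w‖ < R := by simpa [dist_eq_norm] using hv
          exact this.le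
        have h2 : ‖v - c‖ ≤ ‖v - w‖ + ‖w - c‖ := by
          simpa using norm_add_le (v - w) (w - c)
        have h3 : ‖v - c‖ ^ 2 ≤ (R + ‖w - c‖) ^ 2 := by
          gcongr
          linarith
        nlinarith [sq_nonneg (R - ‖w - c‖)]
    _ ≤ _ := setLIntegral_le_lintegral _ _

/-- With probability greater than `1 - ε`, the spectrogram of white noise is bounded by
`O(log (4 / ε))` near a given point and grows at most quadratically. -/
theorem exists_noise_bound : ∃ K : ℝ, 0 ≤ K ∧ ∀ ε : ℝ, 0 < ε → ε < 1 →
    ∀ (Ω : Type*) [MeasurableSpace Ω] (P : Measure Ω) [IsProbabilityMeasure P]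
      (ξ : Ω → 𝓢'(ℝ, ℂ)), IsComplexWhiteNoise P ξ → ∀ c : ℂ,
      ∃ E : Set Ω, MeasurableSet E ∧ ENNReal.ofReal (1 - ε) < P E ∧ ∀ ω ∈ E, ∀ w : ℂ,
        fockNorm (bargmann (ξ ω)) w ^ 2 ≤
          64 / 25 * (Real.log (4 / ε) + K + 2 * ‖w - c‖ ^ 2) := by
  set B : ENNReal := planeGaussMass * (2 * gaussSqMoment) with hB
  have hBtop : B ≠ ⊤ := ENNReal.mul_ne_top planeGaussMass_lt_top.ne
    (ENNReal.mul_ne_top (by norm_num) gaussSqMoment_lt_top.ne)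
  -- The added `1` makes `A` positive, so that its logarithm can be split off.
  set A : ℝ := B.toReal + 1 with hA
  have hA0 : 0 < A := by positivity
  have hBA : B ≤ ENNReal.ofReal A := by
    rw [← ENNReal.ofReal_toReal hBtop]
    exact ENNReal.ofReal_le_ofReal (by linarith)
  have hpi := Real.pi_pos
  refine ⟨2 * (1 / 5) ^ 2 + |Real.log (A / (Real.pi * (1 / 5) ^ 2))|, by positivity,
    fun ε hε hε1 Ω _ P _ ξ h c => ?_⟩
  have hm := h.measurable_expSpecAverage c
  have hmark := mul_meas_ge_le_lintegral hm (μ := P) (ENNReal.ofReal (4 * A / ε))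
  have hcompl : P {ω | ENNReal.ofReal (4 * A / ε) ≤ expSpecAverage (ξ ω) c} ≤
      ENNReal.ofReal (ε / 4) := by
    have h1 : ENNReal.ofReal (4 * A / ε) * P {ω | ENNReal.ofReal (4 * A / ε) ≤
        expSpecAverage (ξ ω) c} ≤ ENNReal.ofReal (4 * A / ε) * ENNReal.ofReal (ε / 4) := by
      refine hmark.trans ((h.lintegral_expSpecAverage_le c).trans (hBA.trans (le_of_eq ?_)))
      rw [← ENNReal.ofReal_mul (by positivity)]
      congr 1
      field_simp
    exact (ENNReal.mul_le_mul_iff_right (by simpa using (by positivity : 0 < 4 * A / ε))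
      ENNReal.ofReal_ne_top).1 h1
  refine ⟨{ω | expSpecAverage (ξ ω) c < ENNReal.ofReal (4 * A / ε)},
    measurableSet_lt hm measurable_const, ?_, fun ω hω w => ?_⟩
  · have h1 : {ω | expSpecAverage (ξ ω) c < ENNReal.ofReal (4 * A / ε)} =
        {ω | ENNReal.ofReal (4 * A / ε) ≤ expSpecAverage (ξ ω) c}ᶜ := by
      ext ω; simp
    rw [h1, prob_compl_eq_one_sub (measurableSet_le measurable_const hm)]
    calc ENNReal.ofReal (1 - ε) < 1 - ENNReal.ofReal (ε / 4) := by
          rw [← ENNReal.ofReal_one, ← ENNReal.ofReal_sub _ (by positivity)]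
          exact (ENNReal.ofReal_lt_ofReal_iff (by linarith)).2 (by linarith)
      _ ≤ _ := tsub_le_tsub_left hcompl 1
  · have h1 := (exp_spec_le_expSpecAverage (ξ ω) c w (R := 1 / 5) (by norm_num)).trans_lt hω
    rw [ENNReal.ofReal_lt_ofReal_iff (by positivity)] at h1
    set V := fockNorm (bargmann (ξ ω)) w ^ 2 with hV
    have hV0 : 0 ≤ V := sq_nonneg _
    have h2 := Real.log_lt_log (by positivity) h1
    have e1 : 4 * A / ε = (4 / ε) * A := by ring
    rw [Real.log_mul (by positivity) (by positivity), Real.log_exp,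
      Real.log_mul (by positivity) (by positivity), Real.log_exp, e1,
      Real.log_mul (by positivity) (by positivity),
      Real.log_mul (by positivity) (by positivity)] at h2
    have h3 : Real.log (A / (Real.pi * (1 / 5) ^ 2)) = Real.log A - Real.log (Real.pi * (1 / 5) ^ 2) :=
      Real.log_div (by positivity) (by positivity)
    rw [Real.log_mul (x := Real.pi) (by positivity) (by positivity)] at h3
    have h4 := le_abs_self (Real.log (A / (Real.pi * (1 / 5) ^ 2)))
    -- The radius `1/5` is small enough to lose little of `9/20`. The target `64/25 = (2 * 4/5)²` is
    -- what the Rouché region with ratio `4/5` tolerates.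
    have h5 : 25 / 64 * V ≤ 9 / 20 * Real.exp (-Real.pi * (1 / 5) ^ 2) * V := by
      gcongr
      have := Real.add_one_le_exp (-Real.pi * (1 / 5) ^ 2)
      have := Real.pi_lt_d2
      linarith
    linarith

/-! ### The transform of a pair of chirps -/

lemma bargmann_chirpPair_eq_integral (γ₁ γ₂ a₁ a₂ b : ℝ) (w : ℂ) :
    bargmann (chirpPair γ₁ γ₂ a₁ a₂ b) w =
      ∫ t : ℝ, chirpPairFun γ₁ γ₂ a₁ a₂ b t * gaussExp w t := by
  have h1 := stft_chirpPair γ₁ γ₂ a₁ a₂ b (starRingEnd ℂ w)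
  rw [stft_eq_bargmann, Complex.conj_conj] at h1
  have h0 : (Real.exp (-Real.pi * (starRingEnd ℂ w).re ^ 2) : ℂ) ≠ 0 := by
    exact_mod_cast (Real.exp_pos _).ne'
  refine mul_left_cancel₀ h0 (h1.trans ?_)
  rw [← integral_const_mul]
  refine integral_congr_ae (Filter.Eventually.of_forall fun t => ?_)
  have h2 := atomFun_eq (starRingEnd ℂ w) t
  rw [Complex.conj_conj, atomFun] at h2
  simp only
  rw [h2]
  ring

/-- The constant in the Gaussian integral of a chirp of rate `b`. -/
def chirpConst (b : ℝ) : ℂ :=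
  ((2 : ℝ) ^ (1 / 4 : ℝ) : ℝ) * (1 / (1 - 2 * Complex.I * b)) ^ (1 / 2 : ℂ)

lemma one_sub_two_I_mul_ne_zero (b : ℝ) : (1 - 2 * Complex.I * b : ℂ) ≠ 0 := fun h => by
  simpa using congrArg Complex.re h

lemma norm_one_sub_two_I_mul (b : ℝ) : ‖(1 - 2 * Complex.I * b : ℂ)‖ = Real.sqrt (1 + 4 * b ^ 2) := by
  rw [Complex.norm_def, Complex.normSq_apply]
  congr 1
  simp
  ring

lemma sigma_eq (b : ℝ) : sigma b = Real.sqrt 2 / Real.sqrt (1 + 4 * b ^ 2) := by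
  rw [sigma, Real.sqrt_div (by norm_num)]

/-- Squaring removes the branch of the complex square root. -/
lemma norm_chirpConst_sq (b : ℝ) : ‖chirpConst b‖ ^ 2 = sigma b := by
  have h1 : ((1 / (1 - 2 * Complex.I * b)) ^ (1 / 2 : ℂ) : ℂ) ^ 2 = 1 / (1 - 2 * Complex.I * b) := by
    rw [← Complex.cpow_nat_mul]
    simp
  rw [chirpConst, norm_mul, mul_pow, ← norm_pow (_ ^ (1 / 2 : ℂ)), h1, norm_div, norm_one,
    norm_one_sub_two_I_mul, Complex.norm_real, Real.norm_eq_abs, sq_abs, ← Real.rpow_natCast,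
    ← Real.rpow_mul (by norm_num), sigma_eq, Real.sqrt_eq_rpow 2]
  norm_num
  rfl

lemma integrable_chirp_mul_gaussExp (a b : ℝ) (w : ℂ) :
    Integrable fun t : ℝ => Complex.exp (2 * Complex.I * Real.pi * t * (a + b * t)) * gaussExp w t := by
  have h : (fun t : ℝ => Complex.exp (2 * Complex.I * Real.pi * t * (a + b * t)) * gaussExp w t) =
      fun t : ℝ => ((2 : ℝ) ^ (1 / 4 : ℝ) : ℝ) * Complex.exp (-(Real.pi * (1 - 2 * Complex.I * b)) * t ^ 2 +
        (2 * Real.pi * (w + Complex.I * a)) * t + 0) := by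
    funext t
    rw [gaussExp, mul_left_comm, ← Complex.exp_add]
    congr 2
    ring
  rw [h]
  refine (integrable_cexp_quadratic' ?_ _ _).const_mul _
  simp [Real.pi_pos]

lemma integral_chirp_mul_gaussExp (a b : ℝ) (w : ℂ) :
    ∫ t : ℝ, Complex.exp (2 * Complex.I * Real.pi * t * (a + b * t)) * gaussExp w t =
      chirpConst b * Complex.exp (Real.pi * (w + Complex.I * a) ^ 2 / (1 - 2 * Complex.I * b)) := by
  have h : (fun t : ℝ => Complex.exp (2 * Complex.I * Real.pi * t * (a + b * t)) * gaussExp w t) =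
      fun t : ℝ => ((2 : ℝ) ^ (1 / 4 : ℝ) : ℝ) * Complex.exp (-(Real.pi * (1 - 2 * Complex.I * b)) * t ^ 2 +
        (2 * Real.pi * (w + Complex.I * a)) * t + 0) := by
    funext t
    rw [gaussExp, mul_left_comm, ← Complex.exp_add]
    congr 2
    ring
  have hb := one_sub_two_I_mul_ne_zero b
  have hpi : (Real.pi : ℂ) ≠ 0 := by exact_mod_cast Real.pi_ne_zero
  rw [h, integral_const_mul, integral_cexp_quadratic (by simp [Real.pi_pos]), chirpConst, ← mul_assoc]
  congr 3
  · rw [neg_neg]; field_simp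
  · field_simp
    ring

theorem bargmann_chirpPair (γ a₁ a₂ b : ℝ) (w : ℂ) :
    bargmann (chirpPair γ γ a₁ a₂ b) w = Real.sqrt γ * chirpConst b *
      (Complex.exp (Real.pi * (w + Complex.I * a₁) ^ 2 / (1 - 2 * Complex.I * b)) +
        Complex.exp (Real.pi * (w + Complex.I * a₂) ^ 2 / (1 - 2 * Complex.I * b))) := by
  rw [bargmann_chirpPair_eq_integral]
  simp only [chirpPairFun, add_mul, mul_assoc (Real.sqrt γ : ℂ)]
  rw [integral_add ((integrable_chirp_mul_gaussExp _ _ _).const_mul _)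
    ((integrable_chirp_mul_gaussExp _ _ _).const_mul _), integral_const_mul, integral_const_mul,
    integral_chirp_mul_gaussExp, integral_chirp_mul_gaussExp]
  ring

/-- The inverse of `z ↦ (r - a / 2) + i (s - s₀)`, followed by complex conjugation. -/
def conjPoint (a₁ a₂ b s₀ : ℝ) (ζ : ℂ) : ℂ :=
  -Complex.I * (1 - 2 * Complex.I * b) / Real.sqrt (1 + 4 * b ^ 2) * (ζ + Complex.I * s₀) -
    Complex.I * ((a₁ + a₂) / 2)

/-- The coordinate `(r - a / 2) + i (s - s₀)` of `z`. -/
def chirpCoord (a₁ a₂ b s₀ : ℝ) (z : ℂ) : ℂ :=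
  ⟨rCoord a₁ b z - gap a₁ a₂ b / 2, sCoord a₁ a₂ b z - s₀⟩

lemma sigma_div_sqrt_two (b : ℝ) : sigma b / Real.sqrt 2 = 1 / Real.sqrt (1 + 4 * b ^ 2) := by
  rw [sigma_eq]
  field_simp

lemma differentiable_conjPoint (a₁ a₂ b s₀ : ℝ) : Differentiable ℂ (conjPoint a₁ a₂ b s₀) := by
  unfold conjPoint
  fun_prop

/-- The linear part is multiplication by a unimodular number, so the distance to the centre in the
noise bound is `‖ζ‖`. -/
lemma norm_conjPoint_sub (a₁ a₂ b s₀ : ℝ) (ζ : ℂ) :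
    ‖conjPoint a₁ a₂ b s₀ ζ - conjPoint a₁ a₂ b s₀ 0‖ = ‖ζ‖ := by
  have h : conjPoint a₁ a₂ b s₀ ζ - conjPoint a₁ a₂ b s₀ 0 =
      -Complex.I * (1 - 2 * Complex.I * b) / Real.sqrt (1 + 4 * b ^ 2) * ζ := by
    unfold conjPoint; ring
  have hB : 0 < Real.sqrt (1 + 4 * b ^ 2) := by positivity
  rw [h, norm_mul, norm_div, norm_mul, norm_one_sub_two_I_mul, norm_neg, Complex.norm_I, one_mul,
    Complex.norm_real, Real.norm_eq_abs, abs_of_pos hB, div_self hB.ne', one_mul]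

lemma conjPoint_re_im (a₁ a₂ b s₀ : ℝ) (ζ : ℂ) :
    (conjPoint a₁ a₂ b s₀ ζ).re = (ζ.im + s₀ - 2 * b * ζ.re) / Real.sqrt (1 + 4 * b ^ 2) ∧
    (conjPoint a₁ a₂ b s₀ ζ).im =
      -(ζ.re + 2 * b * (ζ.im + s₀)) / Real.sqrt (1 + 4 * b ^ 2) - (a₁ + a₂) / 2 := by
  have h : conjPoint a₁ a₂ b s₀ ζ =
      ((ζ.im + s₀ - 2 * b * ζ.re) / Real.sqrt (1 + 4 * b ^ 2) : ℝ) +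
      (-(ζ.re + 2 * b * (ζ.im + s₀)) / Real.sqrt (1 + 4 * b ^ 2) - (a₁ + a₂) / 2 : ℝ) *
        Complex.I := by
    conv_lhs => rw [← Complex.re_add_im ζ]
    unfold conjPoint
    push_cast
    linear_combination ((-2 * b * ζ.re + ζ.im + s₀ ) / Real.sqrt (1 + 4 * b ^ 2) +
      2 * b * (-ζ.im - s₀) / Real.sqrt (1 + 4 * b ^ 2) * Complex.I) * (-Complex.I_sq)
  rw [h]
  simp

lemma conjPoint_chirpCoord (a₁ a₂ b s₀ : ℝ) (z : ℂ) :
    conjPoint a₁ a₂ b s₀ (chirpCoord a₁ a₂ b s₀ z) = starRingEnd ℂ z := by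
  obtain ⟨h1, h2⟩ := conjPoint_re_im a₁ a₂ b s₀ (chirpCoord a₁ a₂ b s₀ z)
  have hB : 0 < Real.sqrt (1 + 4 * b ^ 2) := by positivity
  have hB2 : Real.sqrt (1 + 4 * b ^ 2) ^ 2 = 1 + 4 * b ^ 2 := Real.sq_sqrt (by positivity)
  refine Complex.ext ?_ ?_
  · rw [h1, Complex.conj_re]
    simp only [chirpCoord, rCoord, sCoord, gap, sigma_div_sqrt_two]
    field_simp
    rw [hB2]
    ring
  · rw [h2, Complex.conj_im]
    simp only [chirpCoord, rCoord, sCoord, gap, sigma_div_sqrt_two]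
    field_simp
    rw [hB2]
    ring

lemma chirpCoord_conj_conjPoint (a₁ a₂ b s₀ : ℝ) (ζ : ℂ) :
    chirpCoord a₁ a₂ b s₀ (starRingEnd ℂ (conjPoint a₁ a₂ b s₀ ζ)) = ζ := by
  obtain ⟨h1, h2⟩ := conjPoint_re_im a₁ a₂ b s₀ ζ
  have hB : 0 < Real.sqrt (1 + 4 * b ^ 2) := by positivity
  have hB2 : Real.sqrt (1 + 4 * b ^ 2) ^ 2 = 1 + 4 * b ^ 2 := Real.sq_sqrt (by positivity)
  refine Complex.ext ?_ ?_
  · simp only [chirpCoord, rCoord, sCoord, gap, sigma_div_sqrt_two, Complex.conj_re,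
      Complex.conj_im, h1, h2]
    field_simp
    rw [hB2]
    ring
  · simp only [chirpCoord, rCoord, sCoord, gap, sigma_div_sqrt_two, Complex.conj_re,
      Complex.conj_im, h1, h2]
    field_simp
    rw [hB2]
    ring

lemma cosh_add_I_mul_half_odd (x : ℂ) (N : ℕ) :
    Complex.cosh (x + Real.pi * (N + 1 / 2) * Complex.I) =
      Complex.I * (-1) ^ N * Complex.sinh x := by
  have h1 : Complex.cos (Real.pi * (N + 1 / 2)) = 0 := by
    rw [show (Real.pi * (N + 1 / 2) : ℂ) = Real.pi / 2 + N * Real.pi by ring,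
      Complex.cos_antiperiodic.add_nat_mul_eq, Complex.cos_pi_div_two, mul_zero]
  have h2 : Complex.sin (Real.pi * (N + 1 / 2)) = (-1) ^ N := by
    rw [show (Real.pi * (N + 1 / 2) : ℂ) = Real.pi / 2 + N * Real.pi by ring,
      Complex.sin_antiperiodic.add_nat_mul_eq, Complex.sin_pi_div_two, mul_one]
  rw [Complex.cosh_add, Complex.cosh_mul_I, Complex.sinh_mul_I, h1, h2]
  ring

/-- In the coordinate `ζ`, the transform of a pair of chirps is a hyperbolic sine up to a
nonvanishing holomorphic factor whose modulus is a Gaussian. -/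
theorem bargmann_chirpPair_conjPoint (γ a₁ a₂ b : ℝ) (s₀ : ℝ) (N : ℕ)
    (hs : gap a₁ a₂ b * s₀ = N + 1 / 2) :
    ∃ p : ℂ → ℂ, Differentiable ℂ p ∧
      (∀ ζ, bargmann (chirpPair γ γ a₁ a₂ b) (conjPoint a₁ a₂ b s₀ ζ) =
        p ζ * Complex.sinh (Real.pi * gap a₁ a₂ b * ζ)) ∧
      ∀ ζ, Real.exp (-Real.pi * (conjPoint a₁ a₂ b s₀ ζ).re ^ 2) * ‖p ζ‖ =
        2 * Real.sqrt γ * Real.sqrt (sigma b) *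
          Real.exp (-Real.pi * ζ.re ^ 2 - Real.pi * gap a₁ a₂ b ^ 2 / 4) := by
  have hB : 0 < Real.sqrt (1 + 4 * b ^ 2) := by positivity
  have hB2 : Real.sqrt (1 + 4 * b ^ 2) ^ 2 = 1 + 4 * b ^ 2 := Real.sq_sqrt (by positivity)
  set B := Real.sqrt (1 + 4 * b ^ 2) with hBdef
  have hBc : (B : ℂ) ≠ 0 := by exact_mod_cast hB.ne'
  have hB2c : (B : ℂ) ^ 2 = (1 - 2 * Complex.I * b) * (1 + 2 * Complex.I * b) := by
    have : (B : ℂ) ^ 2 = 1 + 4 * b ^ 2 := by exact_mod_cast hB2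
    rw [this]
    linear_combination (-4 * (b : ℂ) ^ 2) * (-Complex.I_sq)
  have hb := one_sub_two_I_mul_ne_zero b
  have hgap : gap a₁ a₂ b = (a₂ - a₁) / B := by
    rw [gap, sigma_div_sqrt_two]; ring
  set a := gap a₁ a₂ b with ha
  -- The half-sum of the exponents of the two chirps; they are `Q ζ ∓ π a (ζ + i s₀)`, so the sum is
  -- a hyperbolic cosine, shifted to a hyperbolic sine by `a s₀ = N + 1/2`.
  let Q : ℂ → ℂ := fun ζ => ((Real.pi / B ^ 2 : ℝ) : ℂ) *
    (-(1 - 2 * Complex.I * b) * (ζ + Complex.I * s₀) ^ 2 -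
      (1 + 2 * Complex.I * b) * ((a₂ - a₁) ^ 2 / 4 : ℝ))
  refine ⟨fun ζ => Real.sqrt γ * chirpConst b * Complex.exp (Q ζ) * 2 *
    (Complex.I * (-1) ^ N), by fun_prop, fun ζ => ?_, fun ζ => ?_⟩
  · rw [bargmann_chirpPair]
    set x : ℂ := Real.pi * a * ζ with hx
    have hl : x + Real.pi * (N + 1 / 2) * Complex.I = Real.pi * a * (ζ + Complex.I * s₀) := by
      have : ((a * s₀ : ℝ) : ℂ) = N + 1 / 2 := by rw [hs]; push_cast; ring
      rw [← this]; push_cast; ring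
    have hcosh := cosh_add_I_mul_half_odd x N
    rw [hl, Complex.cosh] at hcosh
    have hac : (a : ℂ) = (a₂ - a₁) / B := by rw [hgap]; push_cast; ring
    have hd : (1 + 2 * Complex.I * b : ℂ) = B ^ 2 / (1 - 2 * Complex.I * b) := by
      rw [hB2c]; field_simp
    have e1 : Real.pi * (conjPoint a₁ a₂ b s₀ ζ + Complex.I * a₁) ^ 2 / (1 - 2 * Complex.I * b) =
        Q ζ + -(Real.pi * a * (ζ + Complex.I * s₀)) := by
      have e0 : (conjPoint a₁ a₂ b s₀ ζ + Complex.I * a₁) ^ 2 =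
          -((1 - 2 * Complex.I * b) / B * (ζ + Complex.I * s₀) + (a₂ - a₁) / 2) ^ 2 := by
        unfold conjPoint
        linear_combination ((1 - 2 * Complex.I * b) / B * (ζ + Complex.I * s₀) +
          (a₂ - a₁) / 2) ^ 2 * Complex.I_sq
      simp only [Q]
      rw [e0, hac, hd]
      push_cast
      field_simp
      ring
    have e2 : Real.pi * (conjPoint a₁ a₂ b s₀ ζ + Complex.I * a₂) ^ 2 / (1 - 2 * Complex.I * b) =
        Q ζ + Real.pi * a * (ζ + Complex.I * s₀) := by
      have e0 : (conjPoint a₁ a₂ b s₀ ζ + Complex.I * a₂) ^ 2 =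
          -((1 - 2 * Complex.I * b) / B * (ζ + Complex.I * s₀) - (a₂ - a₁) / 2) ^ 2 := by
        unfold conjPoint
        linear_combination ((1 - 2 * Complex.I * b) / B * (ζ + Complex.I * s₀) -
          (a₂ - a₁) / 2) ^ 2 * Complex.I_sq
      simp only [Q]
      rw [e0, hac, hd]
      push_cast
      field_simp
      ring
    rw [e1, e2, Complex.exp_add, Complex.exp_add]
    linear_combination (2 * Real.sqrt γ * chirpConst b * Complex.exp (Q ζ)) * hcosh
  · have hk : ‖chirpConst b‖ = Real.sqrt (sigma b) := by
      rw [← norm_chirpConst_sq, Real.sqrt_sq (norm_nonneg _)]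
    have hQ : (Q ζ).re = Real.pi / B ^ 2 * ((ζ.im + s₀) ^ 2 - ζ.re ^ 2 -
        4 * b * (ζ.im + s₀) * ζ.re - (a₂ - a₁) ^ 2 / 4) := by
      simp only [Q, Complex.re_ofReal_mul]
      congr 1
      conv_lhs => rw [← Complex.re_add_im ζ]
      simp [pow_two]
      ring
    have e3 : (conjPoint a₁ a₂ b s₀ ζ).re = (ζ.im + s₀ - 2 * b * ζ.re) / B :=
      (conjPoint_re_im a₁ a₂ b s₀ ζ).1
    simp only [norm_mul, norm_pow, norm_neg, norm_one, one_pow, Complex.norm_I, mul_one,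
      Complex.norm_exp, hk, Complex.norm_real, Real.norm_eq_abs, abs_of_nonneg (Real.sqrt_nonneg _),
      Complex.norm_ofNat]
    rw [e3, hQ, hgap]
    have e4 : Real.exp (-Real.pi * ((ζ.im + s₀ - 2 * b * ζ.re) / B) ^ 2) *
        Real.exp (Real.pi / B ^ 2 * ((ζ.im + s₀) ^ 2 - ζ.re ^ 2 -
        4 * b * (ζ.im + s₀) * ζ.re - (a₂ - a₁) ^ 2 / 4)) =
        Real.exp (-Real.pi * ζ.re ^ 2 - Real.pi * ((a₂ - a₁) / B) ^ 2 / 4) := by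
      rw [← Real.exp_add]
      congr 1
      field_simp
      rw [hB2]
      ring
    linear_combination (2 * Real.sqrt γ * Real.sqrt (sigma b)) * e4

/-! ### Rouché's theorem on a disc -/

/-- The maximum modulus principle applied to `exp (-g)`. It replaces the argument principle in both
halves of Rouché's theorem. -/
lemma re_pos_of_re_pos_sphere {g : ℂ → ℂ} {δ : ℝ} (hδ : 0 < δ)
    (hg : DiffContOnCl ℂ g (Metric.ball 0 δ)) (hpos : ∀ Z : ℂ, ‖Z‖ = δ → 0 < (g Z).re)
    {Z : ℂ} (hZ : ‖Z‖ < δ) : 0 < (g Z).re := by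
  have hcont : ContinuousOn (fun Z => (g Z).re) (Metric.sphere 0 δ) := by
    refine Complex.continuous_re.comp_continuousOn (hg.continuousOn.mono ?_)
    rw [closure_ball _ hδ.ne']
    exact Metric.sphere_subset_closedBall
  obtain ⟨W, hW, hmin⟩ := (isCompact_sphere (0 : ℂ) δ).exists_isMinOn
    (NormedSpace.sphere_nonempty.2 hδ.le) hcont
  have hm := hpos W (by simpa using hW)
  have h1 : DiffContOnCl ℂ (fun Z => Complex.exp (-g Z)) (Metric.ball 0 δ) :=
    Complex.differentiable_exp.comp_diffContOnCl hg.neg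
  have h2 := Complex.norm_le_of_forall_mem_frontier_norm_le Metric.isBounded_ball h1
    (C := Real.exp (-(g W).re)) (fun V hV => by
      rw [frontier_ball _ hδ.ne'] at hV
      rw [Complex.norm_exp, Complex.neg_re]
      have := hmin hV
      simp only [Set.mem_ofPred_eq] at this
      gcongr) (subset_closure (by simpa using hZ : Z ∈ Metric.ball (0 : ℂ) δ))
  rw [Complex.norm_exp, Real.exp_le_exp, Complex.neg_re] at h2
  linarith

lemma re_div_add_pos {Z P : ℂ} (h : ‖P‖ < ‖Z‖) : 0 < (Z / (Z + P)).re ∧ 0 < ((Z + P) / Z).re := by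
  have hZ : 0 < ‖Z‖ := (norm_nonneg _).trans_lt h
  have hZ0 : Z ≠ 0 := norm_pos_iff.1 hZ
  have h1 : 0 < ((Z + P) / Z).re := by
    rw [add_div, div_self hZ0, Complex.add_re, Complex.one_re]
    have h2 : ‖P / Z‖ < 1 := by rwa [norm_div, div_lt_one hZ]
    have h3 := (abs_le.1 (Complex.abs_re_le_norm (P / Z))).1
    linarith
  refine ⟨?_, h1⟩
  rw [← inv_div, Complex.inv_re]
  refine div_pos h1 (Complex.normSq_pos.2 fun h0 => ?_)
  simp [h0] at h1

/-- Rouché's theorem on a disc for a perturbation of the identity. -/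
theorem existsUnique_zero_of_norm_lt {Φ : ℂ → ℂ} {δ ρ : ℝ} (hδ : 0 < δ) (hρ : δ < ρ)
    (hΦ : DifferentiableOn ℂ Φ (Metric.ball 0 ρ)) (hlt : ∀ Z : ℂ, ‖Z‖ = δ → ‖Φ Z‖ < δ) :
    ∃! Z : ℂ, ‖Z‖ < δ ∧ Z + Φ Z = 0 := by
  have hsub : Metric.closedBall (0 : ℂ) δ ⊆ Metric.ball 0 ρ := Metric.closedBall_subset_ball hρ
  have hf : DifferentiableOn ℂ (fun Z => Z + Φ Z) (Metric.ball 0 ρ) := differentiableOn_id.add hΦ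
  have hdc : ∀ {g : ℂ → ℂ}, DifferentiableOn ℂ g (Metric.closedBall 0 δ) →
      DiffContOnCl ℂ g (Metric.ball 0 δ) := fun hg =>
    DifferentiableOn.diffContOnCl (by rwa [closure_ball _ hδ.ne'])
  have hne : ∀ Z : ℂ, ‖Z‖ = δ → Z + Φ Z ≠ 0 := by
    intro Z hZ h0
    have := (re_div_add_pos (by rw [hZ]; exact hlt Z hZ : ‖Φ Z‖ < ‖Z‖)).2
    simp [h0] at this
  have hex : ∃ Z : ℂ, ‖Z‖ < δ ∧ Z + Φ Z = 0 := by
    by_contra! hno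
    -- Without a zero this quotient is holomorphic with positive real part on the circle, yet it
    -- vanishes at `0`.
    have h1 : DifferentiableOn ℂ (fun Z => Z / (Z + Φ Z)) (Metric.closedBall 0 δ) := by
      refine differentiableOn_id.div (hf.mono hsub) fun Z hZ => ?_
      rcases (show ‖Z‖ ≤ δ by simpa using hZ).lt_or_eq with h | h
      · exact hno Z h
      · exact hne Z h
    have := re_pos_of_re_pos_sphere hδ (hdc h1) (fun Z hZ =>
      (re_div_add_pos (by rw [hZ]; exact hlt Z hZ : ‖Φ Z‖ < ‖Z‖)).1) (Z := 0) (by simpa using hδ)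
    simp at this
  obtain ⟨Z₁, hZ₁, h0₁⟩ := hex
  refine ⟨Z₁, ⟨hZ₁, h0₁⟩, fun Z₂ ⟨hZ₂, h0₂⟩ => ?_⟩
  by_contra hne12
  have hden : ∀ Z : ℂ, ‖Z‖ ≤ δ → (δ ^ 2 : ℂ) - starRingEnd ℂ Z₁ * Z ≠ 0 := by
    intro Z hZ h0
    have h1 : ‖starRingEnd ℂ Z₁ * Z‖ = δ ^ 2 := by
      rw [← sub_eq_zero.1 h0]
      simp
    rw [norm_mul, RCLike.norm_conj] at h1
    nlinarith [norm_nonneg Z₁, norm_nonneg Z]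
  let f : ℂ → ℂ := fun Z => Z + Φ Z
  have hds : DifferentiableOn ℂ (dslope f Z₁) (Metric.closedBall 0 δ) := by
    refine DifferentiableOn.mono ?_ hsub
    refine (Complex.differentiableOn_dslope ?_).2 hf
    exact Metric.isOpen_ball.mem_nhds (hsub (by simpa using hZ₁.le))
  -- The zero `Z₁` is divided out by a Blaschke-type factor: on the circle the quotient equals `(Z +
  -- Φ Z) / Z` over `|Z - Z₁|²`, of positive real part, whereas it would vanish at a second zero.
  have hg : DifferentiableOn ℂ (fun Z => dslope f Z₁ Z / ((δ ^ 2 : ℂ) - starRingEnd ℂ Z₁ * Z))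
      (Metric.closedBall 0 δ) :=
    hds.div (by fun_prop) fun Z hZ => hden Z (by simpa using hZ)
  have h2 := re_pos_of_re_pos_sphere hδ (hdc hg) (fun Z hZ => ?_) hZ₂
  · rw [dslope_of_ne _ hne12, slope_def_field] at h2
    simp [f, h0₁, h0₂] at h2
  · have hZZ : Z ≠ Z₁ := by rintro rfl; exact hZ₁.ne hZ
    have h3 : (δ ^ 2 : ℂ) = Z * starRingEnd ℂ Z := by
      rw [Complex.mul_conj, Complex.normSq_eq_norm_sq, hZ]; push_cast; rfl
    have h4 : (Z - Z₁) * ((δ ^ 2 : ℂ) - starRingEnd ℂ Z₁ * Z) =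
        Z * (Complex.normSq (Z - Z₁) : ℂ) := by
      rw [h3, ← Complex.mul_conj, map_sub]; ring
    rw [dslope_of_ne _ hZZ, slope_def_field, div_div]
    simp only [f, h0₁, sub_zero]
    rw [h4, ← div_div, Complex.div_ofReal_re]
    refine div_pos (re_div_add_pos (by rw [hZ]; exact hlt Z hZ)).2 ?_
    exact Complex.normSq_pos.2 (sub_ne_zero.2 hZZ)

/-! ### The inverse hyperbolic sine on the unit disc -/

/-- The principal branch of the inverse hyperbolic sine. -/
def carsinh (Z : ℂ) : ℂ := Complex.log (Z + Complex.exp (Complex.log (1 + Z ^ 2) / 2))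

lemma one_add_sq_mem_slitPlane {Z : ℂ} (hZ : ‖Z‖ < 1) : 1 + Z ^ 2 ∈ Complex.slitPlane := by
  refine Complex.mem_slitPlane_of_norm_lt_one ?_
  rw [norm_pow]
  exact pow_lt_one₀ (norm_nonneg _) hZ (by norm_num)

lemma exp_half_log_sq {x : ℂ} (hx : x ≠ 0) : Complex.exp (Complex.log x / 2) ^ 2 = x := by
  rw [← Complex.exp_nat_mul]
  push_cast
  rw [mul_div_cancel₀ _ (two_ne_zero), Complex.exp_log hx]

lemma re_exp_half_log_pos {x : ℂ} (hx : x ∈ Complex.slitPlane) :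
    0 < (Complex.exp (Complex.log x / 2)).re := by
  have h1 := Complex.neg_pi_lt_arg x
  have h2 := Complex.mem_slitPlane_iff_arg.1 hx
  have h3 := lt_of_le_of_ne (Complex.arg_le_pi x) h2.1
  rw [Complex.exp_re]
  refine mul_pos (Real.exp_pos _) (Real.cos_pos_of_mem_Ioo ?_)
  have h4 : (Complex.log x / 2).im = x.arg / 2 := by
    rw [Complex.div_ofNat_im, Complex.log_im]
  rw [h4]
  constructor <;> linarith

/-- With `s` the square root, `s + Z` and `s - Z` are inverse to each other, so their real parts
have the same sign; these sum to `2 Re s > 0`. -/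
lemma carsinh_arg {Z : ℂ} (hZ : ‖Z‖ < 1) :
    (Z + Complex.exp (Complex.log (1 + Z ^ 2) / 2)) *
      (Complex.exp (Complex.log (1 + Z ^ 2) / 2) - Z) = 1 ∧
    0 < (Z + Complex.exp (Complex.log (1 + Z ^ 2) / 2)).re := by
  have h1 := one_add_sq_mem_slitPlane hZ
  have h2 := exp_half_log_sq (Complex.slitPlane_ne_zero h1)
  have h3 := re_exp_half_log_pos h1
  set s := Complex.exp (Complex.log (1 + Z ^ 2) / 2)
  have h4 : (Z + s) * (s - Z) = 1 := by linear_combination h2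
  refine ⟨h4, ?_⟩
  have hq : Z + s ≠ 0 := left_ne_zero_of_mul_eq_one h4
  have h5 : s - Z = (Z + s)⁻¹ := eq_inv_of_mul_eq_one_right h4
  have h6 := congrArg Complex.re h5
  rw [Complex.inv_re, Complex.sub_re] at h6
  have h7 : 0 < Complex.normSq (Z + s) := Complex.normSq_pos.2 hq
  by_contra! hle
  have h8 : (Z + s).re / Complex.normSq (Z + s) ≤ 0 := div_nonpos_of_nonpos_of_nonneg hle h7.le
  rw [← h6] at h8
  rw [Complex.add_re] at hle
  linarith

lemma sinh_carsinh {Z : ℂ} (hZ : ‖Z‖ < 1) : Complex.sinh (carsinh Z) = Z := by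
  obtain ⟨h1, -⟩ := carsinh_arg hZ
  have hq := left_ne_zero_of_mul_eq_one h1
  rw [Complex.sinh, carsinh, Complex.exp_neg, Complex.exp_log hq, ← eq_inv_of_mul_eq_one_right h1]
  ring

lemma abs_im_carsinh_lt {Z : ℂ} (hZ : ‖Z‖ < 1) : |(carsinh Z).im| < Real.pi / 2 := by
  rw [carsinh, Complex.log_im, Complex.abs_arg_lt_pi_div_two_iff]
  exact Or.inl (carsinh_arg hZ).2

lemma differentiableAt_carsinh {Z : ℂ} (hZ : ‖Z‖ < 1) : DifferentiableAt ℂ carsinh Z := by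
  unfold carsinh
  have h1 := one_add_sq_mem_slitPlane hZ
  refine DifferentiableAt.clog ?_ (Complex.mem_slitPlane_iff.2 (Or.inl (carsinh_arg hZ).2))
  refine differentiableAt_id.add (DifferentiableAt.cexp (DifferentiableAt.div_const ?_ 2))
  exact DifferentiableAt.clog (by fun_prop) h1

lemma norm_sinh_sq (p : ℂ) :
    ‖Complex.sinh p‖ ^ 2 = Real.sinh p.re ^ 2 + Real.sin p.im ^ 2 := by
  have h : Complex.sinh p = (Real.sinh p.re * Real.cos p.im : ℝ) +
      (Real.cosh p.re * Real.sin p.im : ℝ) * Complex.I := by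
    conv_lhs => rw [← Complex.re_add_im p]
    rw [Complex.sinh_add, Complex.cosh_mul_I, Complex.sinh_mul_I]
    push_cast
    ring
  rw [h, Complex.sq_norm, Complex.normSq_add_mul_I]
  have h1 := Real.sin_sq_add_cos_sq p.im
  have h2 := Real.cosh_sq p.re
  rw [mul_pow, mul_pow, h2]
  linear_combination Real.sinh p.re ^ 2 * h1

lemma sinh_injOn_strip {p q : ℂ} (hp : |p.im| < Real.pi / 2) (hq : |q.im| < Real.pi / 2)
    (h : Complex.sinh p = Complex.sinh q) : p = q := by
  have hpi := Real.pi_pos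
  rw [abs_lt] at hp hq
  have h1 : Complex.sin (p * Complex.I) = Complex.sin (q * Complex.I) := by
    rw [Complex.sin_mul_I, Complex.sin_mul_I, h]
  obtain ⟨k, hk⟩ := Complex.sin_eq_sin_iff.1 h1
  rcases hk with hk | hk
  · have hre := congrArg Complex.re hk
    have him := congrArg Complex.im hk
    simp at hre him
    have hk0 : k = 0 := by
      have h2 : (-1 : ℝ) < k := by
        by_contra! h3
        nlinarith
      have h3 : (k : ℝ) < 1 := by
        by_contra! h3
        nlinarith
      have h2' : (-1 : ℤ) < k := by exact_mod_cast h2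
      have h3' : k < (1 : ℤ) := by exact_mod_cast h3
      omega
    subst hk0
    refine Complex.ext him.symm ?_
    simp at hre
    linarith
  · exfalso
    have hre := congrArg Complex.re hk
    simp at hre
    have h2 : (-1 : ℝ) < k := by
      by_contra! h3
      nlinarith
    have h3 : (k : ℝ) < 0 := by
      by_contra! h3
      nlinarith
    have h2' : (-1 : ℤ) < k := by exact_mod_cast h2
    have h3' : k < (0 : ℤ) := by exact_mod_cast h3
    omega

/-! ### Comparison of noise and signal -/

lemma sinh_le_three_halves_mul {u : ℝ} (h0 : 0 ≤ u) (h1 : u ≤ 1) : Real.sinh u ≤ 3 / 2 * u := by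
  have h2 := (abs_le.1 (Real.abs_exp_sub_one_sub_id_le (abs_le.2 ⟨by linarith, h1⟩))).2
  have h3 := Real.add_one_le_exp (-u)
  rw [Real.sinh_eq]
  nlinarith

/-- Keeps the Rouché disc inside the unit disc, where `carsinh` is holomorphic. -/
lemma four_fifths_mul_sinh_lt_one {u : ℝ} (h1 : u ≤ 1) : 4 / 5 * Real.sinh u < 1 := by
  have h2 : Real.sinh u ≤ Real.sinh 1 := Real.sinh_le_sinh.2 h1
  have h3 := Real.exp_one_lt_d9
  have h4 : (1 : ℝ) / 4 ≤ Real.exp (-1) := by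
    rw [Real.exp_neg, ← one_div]
    exact one_div_le_one_div_of_le (Real.exp_pos _) (by linarith)
  rw [Real.sinh_eq 1] at h2
  linarith

lemma two_mul_le_abs_sin {a y : ℝ} (ha : 0 < a) (hy : |y| ≤ 1 / (2 * a)) :
    2 * a * |y| ≤ |Real.sin (Real.pi * a * y)| := by
  have hpi := Real.pi_pos
  have h1 : |Real.pi * a * y| ≤ Real.pi / 2 := by
    rw [abs_mul, abs_of_pos (by positivity)]
    calc Real.pi * a * |y| ≤ Real.pi * a * (1 / (2 * a)) := by gcongr
      _ = Real.pi / 2 := by field_simp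
  have h2 := Real.mul_abs_le_abs_sin h1
  rw [abs_mul, abs_of_pos (by positivity : 0 < Real.pi * a)] at h2
  calc 2 * a * |y| = 2 / Real.pi * (Real.pi * a * |y|) := by field_simp
    _ ≤ _ := h2

/-- In `4 (M + L)² q²` the term in `L²` pays for the logarithm. The term `4 M² q²` is split: half of
it, through `q² ≥ 16/25`, pays for `K` and `x²`, the other half, through `q² ≥ y²`, for the growth
in `y`. -/
lemma sq_noise_lt {K L M V x y q : ℝ} (hK : 0 ≤ K) (hL : 0 ≤ L) (hM0 : 0 ≤ M)
    (hM : 2 * K + 5 ≤ M ^ 2) (hq : 16 / 25 ≤ q ^ 2) (hyq : y ^ 2 ≤ q ^ 2) (hx : x ^ 2 ≤ 1 / 4)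
    (hV : V ^ 2 ≤ 64 / 25 * (L ^ 2 + K + 2 * (x ^ 2 + y ^ 2))) :
    V ^ 2 < (2 * (M + L) * q) ^ 2 := by
  have h0 : 0 ≤ 8 * (M * L * q ^ 2) := by positivity
  have e0 : (2 * (M + L) * q) ^ 2 =
    4 * (L ^ 2 * q ^ 2) + 4 * (M ^ 2 * q ^ 2) + 8 * (M * L * q ^ 2) := by ring
  have h2 : L ^ 2 * (16 / 25) ≤ L ^ 2 * q ^ 2 := by gcongr
  have h3 : M ^ 2 * (16 / 25) ≤ M ^ 2 * q ^ 2 := by gcongr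
  have h4 : M ^ 2 * y ^ 2 ≤ M ^ 2 * q ^ 2 := by gcongr
  have h5 : 5 * y ^ 2 ≤ M ^ 2 * y ^ 2 := by
    gcongr
    linarith
  have h6 := sq_nonneg y
  linarith

lemma three_halves_mul_le {a : ℝ} (ha : 0 < a) (ha2 : Real.pi * a ^ 2 ≤ 2) :
    3 / 2 * (Real.pi * a ^ 2 / 2) ≤ 2 * a := by
  have hpi := Real.pi_pos
  have hpi4 := Real.pi_lt_d2
  have h4 : 3 * Real.pi * a ≤ 8 := by
    refine le_of_sq_le_sq ?_ (by norm_num)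
    nlinarith
  nlinarith

/-- The noise bound is smaller than the modulus of the signal outside the region
`‖sinh (π a ζ)‖ < (4 / 5) sinh (π a² / 2)` of the rectangle. -/
lemma noise_lt_signal {a K L M γ σ V : ℝ} {ζ : ℂ} (ha : 0 < a) (ha2 : Real.pi * a ^ 2 ≤ 2)
    (hK : 0 ≤ K) (hL : 0 ≤ L) (hM0 : 0 ≤ M) (hM : 2 * K + 5 ≤ M ^ 2) (hσ : 0 < σ)
    (hγ : 4 * (M + L) ^ 2 / (σ * (1 - Real.exp (-Real.pi * a ^ 2)) ^ 2) ≤ γ)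
    (hx : |ζ.re| ≤ a / 2) (hy : |ζ.im| ≤ 1 / (2 * a))
    (hs : 4 / 5 * Real.sinh (Real.pi * a ^ 2 / 2) ≤ ‖Complex.sinh (Real.pi * a * ζ)‖)
    (hV : V ^ 2 ≤ 64 / 25 * (L ^ 2 + K + 2 * ‖ζ‖ ^ 2)) :
    V < 2 * Real.sqrt γ * Real.sqrt σ * Real.exp (-Real.pi * ζ.re ^ 2 - Real.pi * a ^ 2 / 4) *
      ‖Complex.sinh (Real.pi * a * ζ)‖ := by
  have hpi := Real.pi_pos
  have hpi3 := Real.pi_gt_three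
  set u := Real.pi * a ^ 2 / 2 with hu
  have hu0 : 0 < u := by positivity
  have hu1 : u ≤ 1 := by rw [hu]; linarith
  set S := Real.sinh u with hS
  have hS0 : 0 < S := Real.sinh_pos_iff.2 hu0
  set h := ‖Complex.sinh (Real.pi * a * ζ)‖ with hh
  have hh0 : 0 ≤ h := norm_nonneg _
  -- This identity makes the threshold on `γ` equivalent to `M + L ≤ √γ √σ exp (-u) S`; twice the
  -- right side is a lower bound for the signal on the sides `|Re ζ| = a / 2`.
  have hexp : 1 - Real.exp (-Real.pi * a ^ 2) = 2 * Real.exp (-u) * S := by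
    have e1 : Real.exp (-u) * Real.exp u = 1 := by rw [← Real.exp_add]; simp
    have e2 : Real.exp (-u) * Real.exp (-u) = Real.exp (-Real.pi * a ^ 2) := by
      rw [← Real.exp_add, hu]; congr 1; ring
    rw [hS, Real.sinh_eq]
    linear_combination (-1) * e1 + e2
  have hγ0 : 0 ≤ γ := le_trans (by positivity) hγ
  have hG : M + L ≤ Real.sqrt γ * Real.sqrt σ * Real.exp (-u) * S := by
    rw [hexp, div_le_iff₀ (by positivity)] at hγ
    refine le_of_sq_le_sq ?_ (by positivity)
    rw [mul_pow, mul_pow, mul_pow, Real.sq_sqrt hγ0, Real.sq_sqrt hσ.le]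
    have e0 : γ * (σ * (2 * Real.exp (-u) * S) ^ 2) = 4 * (γ * σ * Real.exp (-u) ^ 2 * S ^ 2) := by
      ring
    linarith
  have hq1 : 4 / 5 ≤ h / S := by rwa [le_div_iff₀ hS0]
  -- Uniformity as `a → 0`: the signal grows along the chirps at least like `2 a |Im ζ|`, while `S ≤
  -- 2 a`.
  have hq2 : |ζ.im| ≤ h / S := by
    rw [le_div_iff₀ hS0]
    have h1 := two_mul_le_abs_sin ha hy
    have h2 : |Real.sin (Real.pi * a * ζ.im)| ≤ h := by
      refine abs_le_of_sq_le_sq ?_ hh0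
      rw [hh, norm_sinh_sq]
      have : (Real.pi * a * ζ : ℂ).im = Real.pi * a * ζ.im := by
        rw [← Complex.ofReal_mul, Complex.im_ofReal_mul]
      rw [this]
      exact le_add_of_nonneg_left (sq_nonneg _)
    have h3 : S ≤ 2 * a :=
      (sinh_le_three_halves_mul hu0.le hu1).trans (three_halves_mul_le ha ha2)
    calc |ζ.im| * S ≤ |ζ.im| * (2 * a) := by gcongr
      _ = 2 * a * |ζ.im| := by ring
      _ ≤ h := h1.trans h2
  have hx1 : ζ.re ^ 2 ≤ (a / 2) ^ 2 := sq_le_sq' (abs_le.1 hx).1 (abs_le.1 hx).2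
  have hπx := mul_le_mul_of_nonneg_left hx1 hpi.le
  have hx2 : ζ.re ^ 2 ≤ 1 / 4 := by
    have h1 : 3 * a ^ 2 ≤ Real.pi * a ^ 2 := by gcongr
    linarith
  have hq3 : 16 / 25 ≤ (h / S) ^ 2 := by
    have := pow_le_pow_left₀ (by norm_num) hq1 2
    linarith
  have hq4 : ζ.im ^ 2 ≤ (h / S) ^ 2 := by
    rw [← sq_abs]
    exact pow_le_pow_left₀ (abs_nonneg _) hq2 2
  have hn : ‖ζ‖ ^ 2 = ζ.re ^ 2 + ζ.im ^ 2 := by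
    rw [Complex.sq_norm, Complex.normSq_apply]; ring
  have hmain : V < 2 * (M + L) * (h / S) := by
    refine lt_of_pow_lt_pow_left₀ 2 (by positivity) ?_
    rw [hn] at hV
    exact sq_noise_lt hK hL hM0 hM hq3 hq4 hx2 hV
  refine hmain.trans_le ?_
  have hexp2 : Real.exp (-u) ≤ Real.exp (-Real.pi * ζ.re ^ 2 - Real.pi * a ^ 2 / 4) := by
    gcongr
    rw [hu]
    linarith
  calc 2 * (M + L) * (h / S)
      ≤ 2 * (Real.sqrt γ * Real.sqrt σ * Real.exp (-u) * S) * (h / S) := by gcongr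
    _ = 2 * Real.sqrt γ * Real.sqrt σ * Real.exp (-u) * h := by field_simp
    _ ≤ _ := by gcongr

/-! ### Zeros in the rectangle -/

lemma abs_re_le_of_norm_sinh_le {a : ℝ} (ha : 0 < a) {ζ : ℂ}
    (h : ‖Complex.sinh (Real.pi * a * ζ)‖ ≤ Real.sinh (Real.pi * a ^ 2 / 2)) :
    |ζ.re| ≤ a / 2 := by
  have hpi := Real.pi_pos
  have h0 : 0 ≤ Real.sinh (Real.pi * a ^ 2 / 2) := (norm_nonneg _).trans h
  have h1 := norm_sinh_sq (Real.pi * a * ζ)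
  have e : (Real.pi * a * ζ : ℂ).re = Real.pi * a * ζ.re := by
    rw [← Complex.ofReal_mul, Complex.re_ofReal_mul]
  rw [e] at h1
  have h2 : |Real.sinh (Real.pi * a * ζ.re)| ≤ Real.sinh (Real.pi * a ^ 2 / 2) := by
    refine abs_le_of_sq_le_sq ?_ h0
    nlinarith [norm_nonneg (Complex.sinh (Real.pi * a * ζ)),
      sq_nonneg (Real.sin (Real.pi * a * ζ : ℂ).im)]
  rw [Real.abs_sinh, Real.sinh_le_sinh, abs_mul, abs_of_pos (by positivity)] at h2
  have h3 : Real.pi * a * |ζ.re| ≤ Real.pi * a * (a / 2) := h2.trans (le_of_eq (by ring))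
  exact le_of_mul_le_mul_left h3 (by positivity)

lemma sigma_pos (b : ℝ) : 0 < sigma b := by
  unfold sigma; positivity

lemma gap_pos {a₁ a₂ : ℝ} (b : ℝ) (h : a₁ < a₂) : 0 < gap a₁ a₂ b := by
  have := sigma_pos b
  have := sub_pos.2 h
  unfold gap; positivity

lemma mem_rect_iff {a₁ a₂ b : ℝ} (h : a₁ < a₂) (N : ℕ) (z : ℂ) :
    z ∈ rect a₁ a₂ b N ↔
      |(chirpCoord a₁ a₂ b ((N + 1 / 2) / gap a₁ a₂ b) z).re| ≤ gap a₁ a₂ b / 2 ∧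
      |(chirpCoord a₁ a₂ b ((N + 1 / 2) / gap a₁ a₂ b) z).im| ≤ 1 / (2 * gap a₁ a₂ b) := by
  have ha := gap_pos b h
  have e1 : (N / gap a₁ a₂ b : ℝ) = (N + 1 / 2) / gap a₁ a₂ b - 1 / (2 * gap a₁ a₂ b) := by
    field_simp; ring
  have e2 : ((N + 1) / gap a₁ a₂ b : ℝ) = (N + 1 / 2) / gap a₁ a₂ b + 1 / (2 * gap a₁ a₂ b) := by
    field_simp; ring
  simp only [rect, Set.mem_ofPred_eq, Set.mem_Icc, chirpCoord, abs_le, e1, e2]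
  constructor
  · rintro ⟨⟨h1, h2⟩, h3, h4⟩
    exact ⟨⟨by linarith, by linarith⟩, by linarith, by linarith⟩
  · rintro ⟨⟨h1, h2⟩, h3, h4⟩
    exact ⟨⟨by linarith, by linarith⟩, by linarith, by linarith⟩

lemma spec_add_eq_zero_iff (y x : 𝓢'(ℝ, ℂ)) (z : ℂ) :
    spec (y + x) z = 0 ↔
      bargmann y (starRingEnd ℂ z) + bargmann x (starRingEnd ℂ z) = 0 := by
  have h1 : bargmann (y + x) (starRingEnd ℂ z) =
      bargmann y (starRingEnd ℂ z) + bargmann x (starRingEnd ℂ z) := rfl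
  have h0 : (Real.exp (-Real.pi * z.re ^ 2) : ℂ) ≠ 0 := by exact_mod_cast (Real.exp_pos _).ne'
  rw [spec, sq_eq_zero_iff, norm_eq_zero, stft_eq_bargmann, h1, mul_eq_zero, or_iff_right h0]

/-- A perturbation of `p ζ * sinh (π a ζ)` smaller than it in the rectangle outside a disc has a
unique zero in the rectangle. -/
theorem existsUnique_zero_of_perturbation {a : ℝ} (ha : 0 < a) (ha2 : Real.pi * a ^ 2 ≤ 2)
    {p Y : ℂ → ℂ} (hp : Differentiable ℂ p) (hp0 : ∀ ζ, p ζ ≠ 0) (hY : Differentiable ℂ Y)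
    (hlt : ∀ ζ : ℂ, |ζ.re| ≤ a / 2 → |ζ.im| ≤ 1 / (2 * a) →
      4 / 5 * Real.sinh (Real.pi * a ^ 2 / 2) ≤ ‖Complex.sinh (Real.pi * a * ζ)‖ →
      ‖Y ζ‖ < ‖p ζ‖ * ‖Complex.sinh (Real.pi * a * ζ)‖) :
    ∃! ζ : ℂ, (|ζ.re| ≤ a / 2 ∧ |ζ.im| ≤ 1 / (2 * a)) ∧
      Y ζ + p ζ * Complex.sinh (Real.pi * a * ζ) = 0 := by
  have hpi := Real.pi_pos
  set S := Real.sinh (Real.pi * a ^ 2 / 2) with hS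
  have hS0 : 0 < S := Real.sinh_pos_iff.2 (by positivity)
  have hS1 : 4 / 5 * S < 1 := four_fifths_mul_sinh_lt_one (by linarith)
  have hπa : (Real.pi * a : ℂ) ≠ 0 := by
    exact_mod_cast (by positivity : (0 : ℝ) < Real.pi * a).ne'
  let c : ℂ → ℂ := fun Z => carsinh Z / (Real.pi * a)
  have hc : ∀ Z, Real.pi * a * c Z = carsinh Z := fun Z => mul_div_cancel₀ _ hπa
  have him : ∀ Z : ℂ, ‖Z‖ < 1 → |(c Z).im| ≤ 1 / (2 * a) := by
    intro Z hZ
    have h1 := abs_im_carsinh_lt hZ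
    rw [← hc, ← Complex.ofReal_mul, Complex.im_ofReal_mul, abs_mul,
      abs_of_pos (by positivity)] at h1
    have h2 : Real.pi * a * |(c Z).im| ≤ Real.pi * a * (1 / (2 * a)) :=
      h1.le.trans (le_of_eq (by field_simp))
    exact le_of_mul_le_mul_left h2 (by positivity)
  have hre : ∀ Z : ℂ, ‖Z‖ ≤ 4 / 5 * S → |(c Z).re| ≤ a / 2 := by
    intro Z hZ
    refine abs_re_le_of_norm_sinh_le ha ?_
    rw [hc, sinh_carsinh (hZ.trans_lt hS1)]
    linarith
  have hΦ : DifferentiableOn ℂ (fun Z => Y (c Z) / p (c Z)) (Metric.ball 0 1) := by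
    intro Z hZ
    have h1 : DifferentiableAt ℂ c Z :=
      (differentiableAt_carsinh (by simpa using hZ)).div_const _
    exact ((hY.differentiableAt.comp Z h1).div (hp.differentiableAt.comp Z h1)
      (hp0 _)).differentiableWithinAt
  -- In the variable `Z = sinh (π a ζ)`, dividing by `p` turns the equation into a perturbation of
  -- the identity.
  obtain ⟨Z₀, ⟨hZ₀, hzero⟩, huniq⟩ := existsUnique_zero_of_norm_lt (δ := 4 / 5 * S) (by positivity)
    hS1 hΦ fun Z hZ => by
      have h1 := hlt (c Z) (hre Z hZ.le) (him Z (hZ ▸ hS1))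
      rw [hc, sinh_carsinh (hZ ▸ hS1), hZ] at h1
      rw [norm_div, div_lt_iff₀ (norm_pos_iff.2 (hp0 _)), mul_comm]
      exact h1 le_rfl
  refine ⟨c Z₀, ⟨⟨hre _ hZ₀.le, him _ (hZ₀.trans hS1)⟩, ?_⟩, ?_⟩
  · rw [hc, sinh_carsinh (hZ₀.trans hS1)]
    have := hp0 (c Z₀)
    field_simp at hzero
    linear_combination hzero
  · rintro ζ ⟨⟨h1, h2⟩, h3⟩
    have h4 : ‖Complex.sinh (Real.pi * a * ζ)‖ < 4 / 5 * S := by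
      by_contra! hle
      have h5 := hlt ζ h1 h2 hle
      rw [eq_neg_of_add_eq_zero_left h3, norm_neg, norm_mul] at h5
      exact lt_irrefl _ h5
    have e : (Real.pi * a * ζ : ℂ).im = Real.pi * a * ζ.im := by
      rw [← Complex.ofReal_mul, Complex.im_ofReal_mul]
    have h5 : |(Real.pi * a * ζ : ℂ).im| < Real.pi / 2 := by
      refine lt_of_le_of_ne ?_ fun heq => ?_
      · rw [e, abs_mul, abs_of_pos (by positivity)]
        calc Real.pi * a * |ζ.im| ≤ Real.pi * a * (1 / (2 * a)) := by gcongr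
          _ = Real.pi / 2 := by field_simp
      -- On the closed horizontal edges `|sinh| ≥ 1 > (4/5) S`, so a zero cannot lie there and
      -- `sinh` is injective where needed.
      · have h6 := norm_sinh_sq (Real.pi * a * ζ)
        have h7 : Real.sin (Real.pi * a * ζ : ℂ).im ^ 2 = 1 := by
          rw [← sq_abs, Real.abs_sin_eq_sin_abs_of_abs_le_pi (by linarith), heq,
            Real.sin_pi_div_two, one_pow]
        rw [h7] at h6
        nlinarith [norm_nonneg (Complex.sinh (Real.pi * a * ζ)),
          sq_nonneg (Real.sinh (Real.pi * a * ζ : ℂ).re)]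
    set Z := Complex.sinh (Real.pi * a * ζ) with hZ
    have hZ1 : ‖Z‖ < 1 := h4.trans hS1
    have h6 : carsinh Z = Real.pi * a * ζ :=
      sinh_injOn_strip (abs_im_carsinh_lt hZ1) h5 (sinh_carsinh hZ1)
    have h7 : c Z = ζ := by
      simp only [c, h6]
      exact mul_div_cancel_left₀ _ hπa
    rw [← h7]
    congr 1
    refine huniq Z ⟨h4, ?_⟩
    simp only [h7]
    have := hp0 ζ
    field_simp
    linear_combination h3

end

end NoisyChirps

theorem proposition7 (N : ℕ) :
    ∃ M : ℝ, 0 < M ∧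
      ∀ ε : ℝ, 0 < ε → ε < 1 / 4 →
      ∀ a₁ a₂ b γ : ℝ, a₁ < a₂ →
      NoisyChirps.gap a₁ a₂ b ≤ Real.sqrt (2 / Real.pi) →
      4 * (M + Real.sqrt (Real.log (4 / ε))) ^ 2 /
          (NoisyChirps.sigma b *
            (1 - Real.exp (-Real.pi * NoisyChirps.gap a₁ a₂ b ^ 2)) ^ 2) ≤ γ →
      ∀ (Ω : Type*) [MeasurableSpace Ω] (P : MeasureTheory.Measure Ω)
        [MeasureTheory.IsProbabilityMeasure P]
        (ξ : Ω → TemperedDistribution ℝ ℂ),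
        NoisyChirps.IsComplexWhiteNoise P ξ →
        ∃ E : Set Ω, MeasurableSet E ∧ ENNReal.ofReal (1 - ε) < P E ∧
          ∀ ω ∈ E, ∃! z : ℂ, z ∈ NoisyChirps.rect a₁ a₂ b N ∧
            NoisyChirps.spec (ξ ω + NoisyChirps.chirpPair γ γ a₁ a₂ b) z = 0 := by
  open NoisyChirps in
  obtain ⟨K, hK, hnoise⟩ := exists_noise_bound
  -- Chosen so that `M² = 2 K + 5`, the requirement of `sq_noise_lt`.
  refine ⟨Real.sqrt (2 * K + 5), by positivity, ?_⟩
  intro ε hε hε1 a₁ a₂ b γ h12 hgap hγ Ω _ P _ ξ hξ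
  set s₀ : ℝ := (N + 1 / 2) / gap a₁ a₂ b with hs₀
  obtain ⟨E, hE, hPE, hb⟩ := hnoise ε hε (by linarith) Ω P ξ hξ (conjPoint a₁ a₂ b s₀ 0)
  refine ⟨E, hE, hPE, fun ω hω => ?_⟩
  have ha := gap_pos b h12
  have hs : gap a₁ a₂ b * s₀ = N + 1 / 2 := mul_div_cancel₀ _ ha.ne'
  obtain ⟨p, hp, hpeq, hpnorm⟩ := bargmann_chirpPair_conjPoint γ a₁ a₂ b s₀ N hs
  have hpi := Real.pi_pos
  have ha2 : Real.pi * gap a₁ a₂ b ^ 2 ≤ 2 := by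
    have h1 := (Real.le_sqrt' ha).1 hgap
    rw [le_div_iff₀ hpi] at h1
    linarith
  have hlog : 0 ≤ Real.log (4 / ε) := Real.log_nonneg (by rw [le_div_iff₀ hε]; linarith)
  have hM : 2 * K + 5 ≤ Real.sqrt (2 * K + 5) ^ 2 := (Real.sq_sqrt (by positivity)).ge
  have hexp1 : Real.exp (-Real.pi * gap a₁ a₂ b ^ 2) < 1 := by
    rw [Real.exp_lt_one_iff]
    nlinarith [sq_pos_of_pos ha]
  have hγ0 : 0 < γ := by
    refine lt_of_lt_of_le ?_ hγ
    have := sigma_pos b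
    have := sub_pos.2 hexp1
    positivity
  have hp0 : ∀ ζ, p ζ ≠ 0 := by
    intro ζ h0
    have h1 := hpnorm ζ
    rw [h0, norm_zero, mul_zero] at h1
    have := sigma_pos b
    exact absurd h1 (by positivity)
  obtain ⟨ζ, ⟨hζ, hzero⟩, huniq⟩ := existsUnique_zero_of_perturbation ha ha2 hp hp0
    ((differentiable_bargmann (ξ ω)).comp (differentiable_conjPoint a₁ a₂ b s₀))
    fun ζ hx hy hsinh => by
      have h1 := noise_lt_signal (V := fockNorm (bargmann (ξ ω)) (conjPoint a₁ a₂ b s₀ ζ)) ha ha2 hK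
        (Real.sqrt_nonneg _) (Real.sqrt_nonneg _) hM (sigma_pos b) hγ hx hy hsinh (by
          rw [Real.sq_sqrt hlog, ← norm_conjPoint_sub a₁ a₂ b s₀ ζ]
          exact hb ω hω _)
      rw [← hpnorm, fockNorm, mul_assoc] at h1
      exact lt_of_mul_lt_mul_left h1 (Real.exp_pos _).le
  simp only [spec_add_eq_zero_iff, mem_rect_iff h12, ← hs₀]
  refine ⟨starRingEnd ℂ (conjPoint a₁ a₂ b s₀ ζ), ⟨?_, ?_⟩, ?_⟩
  · rwa [chirpCoord_conj_conjPoint]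
  · rw [Complex.conj_conj, hpeq]
    exact hzero
  · rintro z ⟨hz, hz0⟩
    have h1 : chirpCoord a₁ a₂ b s₀ z = ζ := by
      refine huniq _ ⟨hz, ?_⟩
      rw [← hpeq, Function.comp_apply, conjPoint_chirpCoord]
      exact hz0
    rw [← h1, conjPoint_chirpCoord, Complex.conj_conj]
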